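/- \textbf{Notation.} For $A,B\subseteq\omega$ write $A=^*B$ if $A\mathbin{\triangle}B$ is finite and $A\subseteq^*B$ if $A\setminus B$ is finite; for functions, $f=^*g$ means $\mathrm{dom}(f)=^*\mathrm{dom}(g)=^*\{x\in\mathrm{dom}(f)\cap\mathrm{dom}(g): f(x)=g(x)\}$. An automorphism $F$ of the Boolean algebra $\mathcal P(\omega)/\mathrm{Fin}$ is \emph{trivial} if there is a bijection $e:X\to Y$ between cofinite subsets of $\omega$ with $F([A])=[e[A\cap X]]$ for all $A\subseteq\omega$, and \emph{nontrivial} otherwise. An \emph{inner model} is a transitive class $V$ containing all ordinals such that $(V,\in)$ satisfies ZFC. Let $\mathcal A$ be the set of $h:\omega\to\omega\setminus\{0\}$ with $\lim_n h(n)=\infty$. For $h\in\mathcal A$, an \emph{$h$-slalom} is a function $G$ on $\omega$ with $G(n)\subseteq\omega^{n+1}$ and $|G(n)|\le h(n)$ for all $n$. Let $\mathcal S$ be the set of all $h$-slaloms, $h\in\mathcal A$, and $\mathsf w_G(n)=|G(n)|$. $G$ \emph{captures} $r\in\omega^\omega$ if $r\restriction(n+1)\in G(n)$ for all $n$. A real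 $r\in\omega^\omega$ is \emph{$V$-bounded} if $r\le b$ pointwise for some $b\in V\cap\omega^\omega$. A map $F:2^{<\omega_1}\to\omega^\omega$ is \emph{Borel} if $F\restriction 2^\delta$ is Borel for every $\delta<\omega_1$. \begin{itemize} \item $\diamondsuit(\mathsf{LP}_V)$: for every Borel $F:2^{<\omega_1}\to\omega^\omega$ and every sequence $\langle h_\alpha:\alpha<\omega_1\rangle$ of members of $\mathcal A\cap V$ there is $g:\omega_1\to\mathcal S\cap V$ with $\mathsf w_{g(\alpha)}=h_\alpha$ for all $\alpha$, such that for every $f:\omega_1\to2$ the set of $\alpha<\omega_1$ such that, if $F(f\restriction\alpha)$ is $V$-bounded, then $g(\alpha)$ captures $F(f\restriction\alpha)$, is stationary. \item $\diamondsuit^-(\mathsf{LP}_V)$: for every sequence $\langle h_\alpha:\alpha<\omega_1\rangle$ of members of $\mathcal A\cap V$ there is $g:\omega_1\to\mathcal S\cap V$ with $\mathsf w_{g(\alpha)}=h_\alpha$ for all $\alpha$, such that $\{\alpha<\omega_1: g(\alpha)\text{ captures }r\}$ is stationary for every $V$-bounded $r\in\omega^\omega$. \item $\dagger(\mathsf{LP}_V)$: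 the same as $\diamondsuit^-(\mathsf{LP}_V)$ with ``nonempty'' in place of ``stationary''. \end{itemize} A \emph{bowtie of involutions} is a sequence $\langle f_\alpha:\alpha<\omega_1\rangle$ where each $f_\alpha$ is a permutation of a set $D_\alpha\subseteq\omega$ without fixed points and with $f_\alpha\circ f_\alpha=\mathrm{id}$, such that (i) $D_\alpha\subseteq^*D_\beta$ and $D_\beta\setminus D_\alpha$ is infinite whenever $\alpha<\beta<\omega_1$; (ii) $f_\alpha=^*f_\beta\restriction D_\alpha$ whenever $\alpha\le\beta<\omega_1$; (iii) for every $A\subseteq\omega$ there is $\delta<\omega_1$ such that, for all $\alpha$ with $\delta\le\alpha<\omega_1$, $f_\alpha[(D_\alpha\setminus D_\delta)\cap A]=^*(D_\alpha\setminus D_\delta)\cap A$ and $f_\alpha[(D_\alpha\setminus D_\delta)\setminus A]=^*(D_\alpha\setminus D_\delta)\setminus A$. \textbf{Theorem.} Let $V$ be an inner model with $\omega_1^V=\omega_1$, and suppose that $\dagger(\mathsf{LP}_V)$, or $\diamondsuit^-(\mathsf{LP}_V)$, or $\diamondsuit(\mathsf{LP}_V)$ holds. Then there is a bowtie of involutions,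 and there is a nontrivial automorphism of $\mathcal P(\omega)/\mathrm{Fin}$. -/

import Mathlib

open scoped Ordinal

universe u

/-! ### Inner models of ZFC -/

/-- The only symbol of the language of set theory: a binary relation symbol. -/
inductive MembershipSymbol : ℕ → Type
  | mem : MembershipSymbol 2

/-- The first-order language of set theory. -/
abbrev setLang : FirstOrder.Language.{0, 0} := ⟨fun _ => Empty, MembershipSymbol⟩

/-- The structure for the language of set theory given by a binary relation `E` on `M`. -/
abbrev setStructure {M : Type*} (E : M → M → Prop) : setLang.Structure M where
  funMap := fun f _ => nomatch f
  RelMap := fun {_} r =>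
    match r with
    | MembershipSymbol.mem => fun v => E (v 0) (v 1)

/-- Truth in `(M, E)` of a first-order formula of the language of set theory whose free variables
are indexed by `Fin n`, under the assignment `v`. -/
def SetHolds {M : Type*} (E : M → M → Prop) {n : ℕ} (φ : setLang.Formula (Fin n))
    (v : Fin n → M) : Prop :=
  letI := setStructure E
  φ.Realize v

/-- `(M, E)` is a model of ZFC. The two schemes range over all first-order formulas, with
parameters from `M`. -/
structure ModelsZFC {M : Type*} (E : M → M → Prop) : Prop where
  extensionality : ∀ x y : M, (∀ z, E z x ↔ E z y) → x = y
  foundation : ∀ x : M, (∃ y, E y x) → ∃ y, E y x ∧ ∀ z, E z y → ¬ E z x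
  pairing : ∀ x y : M, ∃ p, ∀ z, E z p ↔ z = x ∨ z = y
  union : ∀ a : M, ∃ b, ∀ z, E z b ↔ ∃ y, E y a ∧ E z y
  powerset : ∀ a : M, ∃ b, ∀ z, E z b ↔ ∀ w, E w z → E w a
  infinity : ∃ a : M, (∃ e, (∀ z, ¬ E z e) ∧ E e a) ∧
    ∀ x, E x a → ∃ y, (∀ z, E z y ↔ E z x ∨ z = x) ∧ E y a
  separation : ∀ (n : ℕ) (φ : setLang.Formula (Fin (n + 1))) (p : Fin n → M) (a : M),
    ∃ b, ∀ x, E x b ↔ E x a ∧ SetHolds E φ (Fin.cons x p)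
  replacement : ∀ (n : ℕ) (φ : setLang.Formula (Fin (n + 2))) (p : Fin n → M) (a : M),
    (∀ x, E x a → ∀ y y', SetHolds E φ (Fin.cons x (Fin.cons y p)) →
      SetHolds E φ (Fin.cons x (Fin.cons y' p)) → y = y') →
    ∃ b, ∀ y, E y b ↔ ∃ x, E x a ∧ SetHolds E φ (Fin.cons x (Fin.cons y p))
  choice : ∀ a : M, (∀ x, E x a → ∃ z, E z x) →
    (∀ x y z, E x a → E y a → E z x → E z y → x = y) →
    ∃ c, ∀ x, E x a → ∃! z, E z x ∧ E z c

/-- `V` is an inner model of ZFC: a transitive class that contains all ordinals and is, with the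
true membership relation, a model of ZFC. -/
structure IsInnerModel (V : Set ZFSet.{u}) : Prop where
  transitive : ∀ x ∈ V, ∀ y ∈ x, y ∈ V
  ordinals : ∀ x : ZFSet.{u}, x.IsOrdinal → x ∈ V
  modelsZFC : ModelsZFC (fun x y : V => (x : ZFSet.{u}) ∈ (y : ZFSet.{u}))

/-- In the class `V` there is an injection from `x` to `ω`. -/
def CountableIn (V : Set ZFSet.{u}) (x : ZFSet.{u}) : Prop :=
  ∃ i ∈ V, ZFSet.IsFunc x (ω : Ordinal.{u}).toZFSet i ∧
    ∀ a b c, ZFSet.pair a c ∈ i → ZFSet.pair b c ∈ i → a = b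

/-- `x` is the first uncountable ordinal as computed in the class `V`. -/
def IsOmegaOneIn (V : Set ZFSet.{u}) (x : ZFSet.{u}) : Prop :=
  x ∈ V ∧ x.IsOrdinal ∧ ¬ CountableIn V x ∧ ∀ y ∈ x, CountableIn V y

/-! ### Functions and slaloms -/

/-- The set of countable ordinals. -/
abbrev OmegaOne : Type (u + 1) := Set.Iio (ω_ 1 : Ordinal.{u})

/-- The functions assigning to each `n` a finite set `G n` of sequences in `ω ^ (n + 1)`. -/
abbrev PreSlalom : Type := (n : ℕ) → Finset (Fin (n + 1) → ℕ)

/-- The von Neumann natural number `n`. -/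
noncomputable def natCode (n : ℕ) : ZFSet.{u} := (n : Ordinal.{u}).toZFSet

/-- The finite sequence `σ` as a set of ordered pairs. -/
noncomputable def seqCode {k : ℕ} (σ : Fin k → ℕ) : ZFSet.{u} :=
  ZFSet.range fun i : Fin k => ZFSet.pair (natCode i) (natCode (σ i))

/-- The function `f : ω → ω` as a set of ordered pairs. -/
noncomputable def funCode (f : ℕ → ℕ) : ZFSet.{u} :=
  ZFSet.range fun n : ℕ => ZFSet.pair (natCode n) (natCode (f n))

/-- The function `n ↦ G n` as a set of ordered pairs. -/
noncomputable def slalomCode (G : PreSlalom) : ZFSet.{u} :=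
  ZFSet.range fun n : ℕ =>
    ZFSet.pair (natCode n) (ZFSet.range fun σ : {σ // σ ∈ G n} => seqCode σ.1)

/-- The admissible widths: nowhere zero functions tending to infinity. -/
def admissible : Set (ℕ → ℕ) :=
  {h | (∀ n, h n ≠ 0) ∧ Filter.Tendsto h Filter.atTop Filter.atTop}

/-- `G` is an `h`-slalom. -/
def IsSlalom (h : ℕ → ℕ) (G : PreSlalom) : Prop := ∀ n, (G n).card ≤ h n

/-- The set of all `h`-slaloms with `h` admissible. -/
def slaloms : Set PreSlalom := {G | ∃ h ∈ admissible, IsSlalom h G}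

/-- The width of a slalom. -/
def slalomWidth (G : PreSlalom) : ℕ → ℕ := fun n => (G n).card

/-- `G` captures `r` if `r ↾ (n + 1) ∈ G n` for every `n`. -/
def Captures (G : PreSlalom) (r : ℕ → ℕ) : Prop :=
  ∀ n, (fun i : Fin (n + 1) => r i) ∈ G n

/-- `r` is bounded by some `b : ω → ω` in `V`. -/
def IsBoundedOver (V : Set ZFSet.{u}) (r : ℕ → ℕ) : Prop :=
  ∃ b : ℕ → ℕ, funCode b ∈ V ∧ ∀ n, r n ≤ b n

/-! ### The guessing principles -/

/-- A sequence of length `ω₁` of functions in `𝒜 ∩ V`. -/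
def IsWidthSequence (V : Set ZFSet.{u}) (h : OmegaOne.{u} → ℕ → ℕ) : Prop :=
  ∀ α, h α ∈ admissible ∧ funCode (h α) ∈ V

/-- A sequence of length `ω₁` of slaloms in `V` with the prescribed widths. -/
def IsSlalomSequence (V : Set ZFSet.{u}) (h : OmegaOne.{u} → ℕ → ℕ)
    (g : OmegaOne.{u} → PreSlalom) : Prop :=
  ∀ α, g α ∈ slaloms ∧ slalomCode (g α) ∈ V ∧ slalomWidth (g α) = h α

/-- A map `F : 2 ^ {< ω₁} → ω ^ ω`, given by its restrictions to the levels `2 ^ α`, is Borel if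
each of these restrictions is. -/
def IsBorelMap (F : (α : OmegaOne.{u}) → (Set.Iio α → Bool) → (ℕ → ℕ)) : Prop :=
  ∀ α, @Measurable _ _ (borel (Set.Iio α → Bool)) (borel (ℕ → ℕ)) (F α)

/-- The principle `◇(LP_V)`. -/
def DiamondLP (V : Set ZFSet.{u}) : Prop :=
  ∀ F : (α : OmegaOne.{u}) → (Set.Iio α → Bool) → (ℕ → ℕ), IsBorelMap F →
    ∀ h : OmegaOne.{u} → ℕ → ℕ, IsWidthSequence V h →
      ∃ g : OmegaOne.{u} → PreSlalom, IsSlalomSequence V h g ∧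
        ∀ f : OmegaOne.{u} → Bool,
          IsStationary {α : OmegaOne.{u} | IsBoundedOver V (F α fun ξ => f ξ.1) →
            Captures (g α) (F α fun ξ => f ξ.1)}

/-- The principle `◇⁻(LP_V)`. -/
def DiamondMinusLP (V : Set ZFSet.{u}) : Prop :=
  ∀ h : OmegaOne.{u} → ℕ → ℕ, IsWidthSequence V h →
    ∃ g : OmegaOne.{u} → PreSlalom, IsSlalomSequence V h g ∧
      ∀ r : ℕ → ℕ, IsBoundedOver V r → IsStationary {α : OmegaOne.{u} | Captures (g α) r}

/-- The principle `†(LP_V)`. -/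
def DaggerLP (V : Set ZFSet.{u}) : Prop :=
  ∀ h : OmegaOne.{u} → ℕ → ℕ, IsWidthSequence V h →
    ∃ g : OmegaOne.{u} → PreSlalom, IsSlalomSequence V h g ∧
      ∀ r : ℕ → ℕ, IsBoundedOver V r → {α : OmegaOne.{u} | Captures (g α) r}.Nonempty

/-! ### Bowties -/

/-- `A =* B`. -/
def AlmostEq (A B : Set ℕ) : Prop := (symmDiff A B).Finite

/-- A bowtie of functions. The values of `f α` outside `D α` are irrelevant. -/
structure IsBowtie (D : OmegaOne.{u} → Set ℕ) (f : OmegaOne.{u} → ℕ → ℕ) : Prop where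
  bijOn : ∀ α, Set.BijOn (f α) (D α) (D α)
  no_fixed_points : ∀ α, ∀ x ∈ D α, f α x ≠ x
  increasing : ∀ α β, α < β → (D α \ D β).Finite ∧ (D β \ D α).Infinite
  /-- `f α =* f β ↾ D α` as partial functions: the two domains and the set on which the two
  functions are both defined and agree are almost equal. -/
  coherent : ∀ α β, α ≤ β → AlmostEq (D α) (D β ∩ D α) ∧
    AlmostEq (D β ∩ D α) {x | x ∈ D α ∧ x ∈ D β ∩ D α ∧ f α x = f β x}
  invariant : ∀ A : Set ℕ, ∃ δ : OmegaOne.{u}, ∀ α, δ ≤ α →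
    AlmostEq (f α '' ((D α \ D δ) ∩ A)) ((D α \ D δ) ∩ A) ∧
    AlmostEq (f α '' ((D α \ D δ) \ A)) ((D α \ D δ) \ A)

/-- A bowtie of involutions. -/
def IsBowtieOfInvolutions (D : OmegaOne.{u} → Set ℕ) (f : OmegaOne.{u} → ℕ → ℕ) : Prop :=
  IsBowtie D f ∧ ∀ α, ∀ x ∈ D α, f α (f α x) = x

/-! ### The Boolean algebra `P(ω)/Fin` and its automorphisms -/

theorem almostEq_iff {A B : Set ℕ} : AlmostEq A B ↔ (A \ B).Finite ∧ (B \ A).Finite := by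
  unfold AlmostEq
  rw [Set.symmDiff_def, Set.finite_union]

theorem diff_finite_trans {A B C : Set ℕ} (h : (A \ B).Finite) (h' : (B \ C).Finite) :
    (A \ C).Finite := by
  refine (h.union h').subset ?_
  intro x hx
  by_cases hb : x ∈ B
  · exact Or.inr ⟨hb, hx.2⟩
  · exact Or.inl ⟨hx.1, hb⟩

/-- The relation `=*` on subsets of `ω`. -/
instance almostEqSetoid : Setoid (Set ℕ) where
  r := AlmostEq
  iseqv :=
    { refl := fun A => by simp [almostEq_iff]
      symm := fun h => by
        rw [almostEq_iff] at h ⊢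
        exact ⟨h.2, h.1⟩
      trans := fun h h' => by
        rw [almostEq_iff] at h h' ⊢
        exact ⟨diff_finite_trans h.1 h'.1, diff_finite_trans h'.2 h.2⟩ }

/-- `P(ω)/Fin`. -/
def PModFin : Type := Quotient almostEqSetoid

namespace PModFin

/-- The class `[A]` of `A` modulo `Fin`. -/
def mk (A : Set ℕ) : PModFin := Quotient.mk almostEqSetoid A

theorem mk_eq_mk {A B : Set ℕ} : mk A = mk B ↔ (A \ B).Finite ∧ (B \ A).Finite :=
  (Quotient.eq (r := almostEqSetoid)).trans almostEq_iff

/-- `P(ω)/Fin` with `[A] ≤ [B]` if and only if `A \ B` is finite, and the operations induced by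
union, intersection and complement. -/
instance : BooleanAlgebra PModFin where
  le := Quotient.lift₂ (fun A B => (A \ B).Finite) (by
    intro A B A' B' h h'
    have h := almostEq_iff.1 h
    have h' := almostEq_iff.1 h'
    exact propext ⟨fun k => diff_finite_trans h.2 (diff_finite_trans k h'.1),
      fun k => diff_finite_trans h.1 (diff_finite_trans k h'.2)⟩)
  le_refl := by
    rintro ⟨A⟩
    change (A \ A).Finite
    simp
  le_trans := by
    rintro ⟨A⟩ ⟨B⟩ ⟨C⟩ h h'
    exact diff_finite_trans (A := A) (B := B) (C := C) h h'
  le_antisymm := by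
    rintro ⟨A⟩ ⟨B⟩ h h'
    exact mk_eq_mk.2 ⟨h, h'⟩
  sup := Quotient.lift₂ (fun A B => mk (A ∪ B)) (by
    intro A B A' B' h h'
    have h := almostEq_iff.1 h
    have h' := almostEq_iff.1 h'
    refine mk_eq_mk.2 ⟨(h.1.union h'.1).subset ?_, (h.2.union h'.2).subset ?_⟩ <;>
    · intro x hx
      simp only [Set.mem_sdiff, Set.mem_union] at hx ⊢
      tauto)
  inf := Quotient.lift₂ (fun A B => mk (A ∩ B)) (by
    intro A B A' B' h h'
    have h := almostEq_iff.1 h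
    have h' := almostEq_iff.1 h'
    refine mk_eq_mk.2 ⟨(h.1.union h'.1).subset ?_, (h.2.union h'.2).subset ?_⟩ <;>
    · intro x hx
      simp only [Set.mem_sdiff, Set.mem_union, Set.mem_inter_iff] at hx ⊢
      tauto)
  compl := Quotient.lift (fun A => mk Aᶜ) (by
    intro A A' h
    have h := almostEq_iff.1 h
    refine mk_eq_mk.2 ⟨h.2.subset ?_, h.1.subset ?_⟩ <;>
    · intro x hx
      simp only [Set.mem_sdiff, Set.mem_compl_iff] at hx ⊢
      tauto)
  top := mk Set.univ
  bot := mk ∅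
  le_sup_left := by
    rintro ⟨A⟩ ⟨B⟩
    change (A \ (A ∪ B)).Finite
    refine Set.finite_empty.subset fun x hx => ?_
    simp only [Set.mem_sdiff, Set.mem_union] at hx
    tauto
  le_sup_right := by
    rintro ⟨A⟩ ⟨B⟩
    change (B \ (A ∪ B)).Finite
    refine Set.finite_empty.subset fun x hx => ?_
    simp only [Set.mem_sdiff, Set.mem_union] at hx
    tauto
  sup_le := by
    rintro ⟨A⟩ ⟨B⟩ ⟨C⟩ (h : (A \ C).Finite) (h' : (B \ C).Finite)
    change ((A ∪ B) \ C).Finite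
    rw [Set.union_sdiff_distrib]
    exact h.union h'
  inf_le_left := by
    rintro ⟨A⟩ ⟨B⟩
    change ((A ∩ B) \ A).Finite
    refine Set.finite_empty.subset fun x hx => ?_
    simp only [Set.mem_sdiff, Set.mem_inter_iff] at hx
    tauto
  inf_le_right := by
    rintro ⟨A⟩ ⟨B⟩
    change ((A ∩ B) \ B).Finite
    refine Set.finite_empty.subset fun x hx => ?_
    simp only [Set.mem_sdiff, Set.mem_inter_iff] at hx
    tauto
  le_inf := by
    rintro ⟨A⟩ ⟨B⟩ ⟨C⟩ (h : (A \ B).Finite) (h' : (A \ C).Finite)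
    change (A \ (B ∩ C)).Finite
    rw [Set.sdiff_inter]
    exact h.union h'
  le_sup_inf := by
    rintro ⟨A⟩ ⟨B⟩ ⟨C⟩
    change (((A ∪ B) ∩ (A ∪ C)) \ (A ∪ (B ∩ C))).Finite
    rw [Set.union_inter_distrib_left]
    simp
  inf_compl_le_bot := by
    rintro ⟨A⟩
    change ((A ∩ Aᶜ) \ ∅).Finite
    simp
  top_le_sup_compl := by
    rintro ⟨A⟩
    change (Set.univ \ (A ∪ Aᶜ)).Finite
    simp
  le_top := by
    rintro ⟨A⟩
    change (A \ Set.univ).Finite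
    simp
  bot_le := by
    rintro ⟨A⟩
    change ((∅ : Set ℕ) \ A).Finite
    simp

end PModFin

/-- An automorphism of the Boolean algebra `P(ω)/Fin` is trivial if it is induced by an almost
permutation of `ω`, that is, by a bijection `e : X → Y` between cofinite subsets of `ω`. -/
def IsTrivialAut (F : PModFin ≃o PModFin) : Prop :=
  ∃ (X Y : Set ℕ) (e : ℕ → ℕ), Xᶜ.Finite ∧ Yᶜ.Finite ∧ Set.BijOn e X Y ∧
    ∀ A : Set ℕ, F (PModFin.mk A) = PModFin.mk (e '' (A ∩ X))

/-! Cut `ω` into finite blocks `L n` with at least `2 ^ 2 ^ n` points, eventually more than `n + 2 ^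
(k * (n + 1))` for each fixed `k`. Apply `†` with widths `n + 1` to reals coding the initial parts
of a set `A`. This gives families `C α n` of at most `n + 1` finite sets such that every `A` is
guessed by some `δ`: its part below the end of block `n` is in `C δ n` for all `n`. What this takes
from `V` is that it contains the width `n + 1` and a bound `2 ^ 2 ^ 2 ^ (n + 1)` for the codes. Both
diamonds imply `†`.

A recursion on `α < ω₁` builds blockwise involutions `f α`. On almost every block `f α` properly
extends each earlier `f γ`, and it moves the points fixed by `f γ` without crossing any set in `C β
n`, for each `β ≤ γ`. At a stage, the countably many predecessors are handled by diagonalisation: on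
block `n` only the first `κ n + 1` of them count, with `κ` tending slowly to infinity. The
pigeonhole principle then finds two fixed points that no relevant guess separates, and these are
swapped (`exists_involution_extending`, `exists_common_guidedExtension`). If `δ` guesses `A`, every
later `f α` preserves `A` modulo finite outside the support of `f δ`. The supports and the `f α`
form the bowtie.

For each `A` the preimages under `f α` stabilise modulo finite, and their eventual value defines an
automorphism. If a map `e` induced it, `e` would agree with each `f α` almost everywhere on the
support of `f α` (`finite_moved_ne`). The set of smaller points of the 2-cycles of `e` would then
split almost every new pair of `f α`, against invariance. -/

/-! ### Closure properties of transitive models -/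

/-- The predicate `P` on assignments in `V` is defined by a first-order formula over `(V, ∈)`. -/
def DefinableIn (V : Set ZFSet.{u}) {α : Type} (P : (α → V) → Prop) : Prop :=
  ∃ φ : setLang.Formula α, ∀ v,
    (letI := setStructure (fun x y : V => (x : ZFSet.{u}) ∈ (y : ZFSet.{u})); φ.Realize v) ↔ P v

namespace DefinableIn

variable {V : Set ZFSet.{u}} {α : Type} {P Q : (α → V) → Prop}

theorem mem (i j : α) : DefinableIn V fun v => (v i : ZFSet.{u}) ∈ (v j : ZFSet.{u}) := by
  refine ⟨FirstOrder.Language.Relations.formula (L := setLang) (n := 2) MembershipSymbol.mem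
    ![FirstOrder.Language.Term.var i, FirstOrder.Language.Term.var j], fun v => ?_⟩
  simp only [FirstOrder.Language.Formula.realize_rel]
  rfl

theorem eq (i j : α) : DefinableIn V fun v => v i = v j := by
  refine ⟨FirstOrder.Language.Term.equal (FirstOrder.Language.Term.var i)
    (FirstOrder.Language.Term.var j), fun v => ?_⟩
  simp only [FirstOrder.Language.Formula.realize_equal]
  rfl

theorem not (hP : DefinableIn V P) : DefinableIn V fun v => ¬ P v := by
  obtain ⟨φ, hφ⟩ := hP
  let := setStructure (fun x y : V => (x : ZFSet.{u}) ∈ (y : ZFSet.{u}))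
  exact ⟨φ.not, fun v => FirstOrder.Language.Formula.realize_not.trans (not_congr (hφ v))⟩

theorem and (hP : DefinableIn V P) (hQ : DefinableIn V Q) : DefinableIn V fun v => P v ∧ Q v := by
  obtain ⟨φ, hφ⟩ := hP
  obtain ⟨ψ, hψ⟩ := hQ
  let := setStructure (fun x y : V => (x : ZFSet.{u}) ∈ (y : ZFSet.{u}))
  exact ⟨φ ⊓ ψ, fun v =>
    FirstOrder.Language.BoundedFormula.realize_inf.trans (and_congr (hφ v) (hψ v))⟩

theorem congr (hP : DefinableIn V P) (h : ∀ v, Q v ↔ P v) : DefinableIn V Q := by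
  rwa [show Q = P from funext fun v => propext (h v)]

theorem or (hP : DefinableIn V P) (hQ : DefinableIn V Q) : DefinableIn V fun v => P v ∨ Q v :=
  (hP.not.and hQ.not).not.congr fun v => by tauto

theorem imp (hP : DefinableIn V P) (hQ : DefinableIn V Q) : DefinableIn V fun v => P v → Q v :=
  (hP.and hQ.not).not.congr fun v => by tauto

theorem iff (hP : DefinableIn V P) (hQ : DefinableIn V Q) : DefinableIn V fun v => P v ↔ Q v :=
  ((hP.imp hQ).and (hQ.imp hP)).congr fun v => by tauto

theorem ex {R : (α → V) → V → Prop}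
    (hR : DefinableIn V fun w : α ⊕ Unit → V => R (fun a => w (.inl a)) (w (.inr ()))) :
    DefinableIn V fun v => ∃ x, R v x := by
  obtain ⟨φ, hφ⟩ := hR
  let := setStructure (fun x y : V => (x : ZFSet.{u}) ∈ (y : ZFSet.{u}))
  refine ⟨φ.iExs Unit, fun v => FirstOrder.Language.Formula.realize_iExs.trans ?_⟩
  constructor
  · rintro ⟨i, hi⟩
    exact ⟨i (), (hφ _).1 hi⟩
  · rintro ⟨x, hx⟩
    exact ⟨fun _ => x, (hφ _).2 hx⟩

theorem all {R : (α → V) → V → Prop}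
    (hR : DefinableIn V fun w : α ⊕ Unit → V => R (fun a => w (.inl a)) (w (.inr ()))) :
    DefinableIn V fun v => ∀ x, R v x :=
  (DefinableIn.ex (R := fun v x => ¬ R v x) hR.not).not.congr fun v => by simp

end DefinableIn

/-! ### Pairing, separation and definability of basic notions in `V` -/

namespace IsInnerModel

variable {V : Set ZFSet.{u}}

theorem ext_iff (hV : IsInnerModel V) {x y : ZFSet.{u}} (hx : x ∈ V) (hy : y ∈ V) :
    x = y ↔ ∀ z : V, (z : ZFSet.{u}) ∈ x ↔ (z : ZFSet.{u}) ∈ y := by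
  refine ⟨fun h z => by rw [h], fun h => ZFSet.ext fun z => ⟨fun hz => ?_, fun hz => ?_⟩⟩
  · exact (h ⟨z, hV.transitive _ hx _ hz⟩).1 hz
  · exact (h ⟨z, hV.transitive _ hy _ hz⟩).2 hz

theorem upair_mem (hV : IsInnerModel V) {x y : ZFSet.{u}} (hx : x ∈ V) (hy : y ∈ V) :
    ({x, y} : ZFSet.{u}) ∈ V := by
  obtain ⟨p, hp⟩ := hV.modelsZFC.pairing ⟨x, hx⟩ ⟨y, hy⟩
  convert p.2
  ext z
  rw [ZFSet.mem_pair]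
  constructor
  · rintro (rfl | rfl)
    · exact (hp ⟨_, hx⟩).2 (Or.inl rfl)
    · exact (hp ⟨_, hy⟩).2 (Or.inr rfl)
  · intro hz
    simpa [Subtype.ext_iff] using (hp ⟨z, hV.transitive _ p.2 _ hz⟩).1 hz

theorem pair_mem (hV : IsInnerModel V) {x y : ZFSet.{u}} (hx : x ∈ V) (hy : y ∈ V) :
    ZFSet.pair x y ∈ V := by
  have h := hV.upair_mem (hV.upair_mem hx hx) (hV.upair_mem hx hy)
  rwa [ZFSet.pair_eq_singleton] at h

theorem insert_mem (hV : IsInnerModel V) {x y : ZFSet.{u}} (hx : x ∈ V) (hy : y ∈ V) :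
    insert x y ∈ V := by
  obtain ⟨b, hb⟩ := hV.modelsZFC.union ⟨_, hV.upair_mem (hV.upair_mem hx hx) hy⟩
  convert b.2
  ext z
  rw [ZFSet.mem_insert_iff]
  constructor
  · rintro (rfl | hz)
    · exact (hb ⟨z, hx⟩).2 ⟨⟨_, hV.upair_mem hx hx⟩, by simp, by simp⟩
    · exact (hb ⟨z, hV.transitive _ hy _ hz⟩).2 ⟨⟨y, hy⟩, by simp, hz⟩
  · intro hz
    obtain ⟨w, hw, hzw⟩ := (hb ⟨z, hV.transitive _ b.2 _ hz⟩).1 hz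
    rcases ZFSet.mem_pair.1 hw with h | h
    · left
      simpa [h] using hzw
    · right
      simpa [h] using hzw

theorem exists_powerset (hV : IsInnerModel V) {a : ZFSet.{u}} (ha : a ∈ V) :
    ∃ b ∈ V, ∀ x ∈ V, x ⊆ a → x ∈ b := by
  obtain ⟨b, hb⟩ := hV.modelsZFC.powerset ⟨a, ha⟩
  exact ⟨b, b.2, fun x hx hxa => (hb ⟨x, hx⟩).2 fun w hw => hxa hw⟩

theorem exists_sep (hV : IsInnerModel V) {n : ℕ} {P : (Fin (n + 1) → V) → Prop}
    (hP : DefinableIn V P) (p : Fin n → V) {a : ZFSet.{u}} (ha : a ∈ V) :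
    ∃ b ∈ V, ∀ x : V, (x : ZFSet.{u}) ∈ b ↔ (x : ZFSet.{u}) ∈ a ∧ P (Fin.cons x p) := by
  obtain ⟨φ, hφ⟩ := hP
  obtain ⟨b, hb⟩ := hV.modelsZFC.separation n φ p ⟨a, ha⟩
  exact ⟨b, b.2, fun x => (hb x).trans (and_congr_right fun _ => hφ _)⟩

theorem mem_of_definable (hV : IsInnerModel V) {n : ℕ} {P : (Fin (n + 1) → V) → Prop}
    (hP : DefinableIn V P) (p : Fin n → V) {a c : ZFSet.{u}} (ha : a ∈ V) (hca : ∀ x ∈ c, x ∈ a)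
    (hc : ∀ x : V, (x : ZFSet.{u}) ∈ c ↔ P (Fin.cons x p)) : c ∈ V := by
  obtain ⟨b, hb, h⟩ := hV.exists_sep hP p ha
  convert hb
  ext x
  constructor
  · intro hx
    exact (h ⟨x, hV.transitive _ ha _ (hca x hx)⟩).2 ⟨hca x hx, (hc _).1 hx⟩
  · intro hx
    exact (hc ⟨x, hV.transitive _ hb _ hx⟩).2 ((h _).1 hx).2

theorem definable_upair (hV : IsInnerModel V) {α : Type} (i j k : α) :
    DefinableIn V fun v => (v i : ZFSet.{u}) = {(v j : ZFSet.{u}), (v k : ZFSet.{u})} := by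
  refine DefinableIn.congr (P := fun v => ∀ z : V, (z : ZFSet.{u}) ∈ (v i : ZFSet.{u}) ↔
    z = v j ∨ z = v k) ?_ fun v => ?_
  · exact .all (.iff (.mem _ _) (.or (.eq _ _) (.eq _ _)))
  · rw [hV.ext_iff (v i).2 (hV.upair_mem (v j).2 (v k).2)]
    simp [Subtype.ext_iff]

theorem definable_pair (hV : IsInnerModel V) {α : Type} (i j k : α) :
    DefinableIn V fun v => (v i : ZFSet.{u}) = ZFSet.pair (v j) (v k) := by
  refine DefinableIn.congr (P := fun v => ∃ s t : V,
    (s : ZFSet.{u}) = {(v j : ZFSet.{u}), (v j : ZFSet.{u})} ∧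
    (t : ZFSet.{u}) = {(v j : ZFSet.{u}), (v k : ZFSet.{u})} ∧
    (v i : ZFSet.{u}) = {(s : ZFSet.{u}), (t : ZFSet.{u})}) ?_ fun v => ?_
  · exact .ex (.ex (.and (hV.definable_upair _ _ _) (.and (hV.definable_upair _ _ _)
      (hV.definable_upair _ _ _))))
  · constructor
    · intro h
      refine ⟨⟨_, hV.upair_mem (v j).2 (v j).2⟩, ⟨_, hV.upair_mem (v j).2 (v k).2⟩, rfl, rfl, ?_⟩
      simp [h, ZFSet.pair]
    · rintro ⟨s, t, hs, ht, h⟩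
      rw [h, hs, ht, ZFSet.pair_eq_singleton, ZFSet.pair]

theorem definable_insert_self (hV : IsInnerModel V) {α : Type} (i j : α) :
    DefinableIn V fun v => (v i : ZFSet.{u}) = insert (v j : ZFSet.{u}) (v j : ZFSet.{u}) := by
  refine DefinableIn.congr (P := fun v => ∀ z : V, (z : ZFSet.{u}) ∈ (v i : ZFSet.{u}) ↔
    z = v j ∨ (z : ZFSet.{u}) ∈ (v j : ZFSet.{u})) ?_ fun v => ?_
  · exact .all (.iff (.mem _ _) (.or (.eq _ _) (.mem _ _)))
  · rw [hV.ext_iff (v i).2 (hV.insert_mem (v j).2 (v j).2)]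
    simp [Subtype.ext_iff]

end IsInnerModel

/-! ### Codes of natural numbers and of functions -/

theorem natCode_injective : Function.Injective natCode.{u} := fun _ _ h =>
  Nat.cast_injective (Ordinal.toZFSet_injective h)

theorem natCode_zero : natCode.{u} 0 = ∅ := by simp [natCode]

theorem natCode_succ (n : ℕ) : natCode.{u} (n + 1) = insert (natCode n) (natCode n) := by
  simp [natCode]

theorem mem_omega_toZFSet {x : ZFSet.{u}} :
    x ∈ (ω : Ordinal.{u}).toZFSet ↔ ∃ n : ℕ, x = natCode n := by
  rw [Ordinal.mem_toZFSet_iff]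
  constructor
  · rintro ⟨a, ha, rfl⟩
    obtain ⟨n, rfl⟩ := Ordinal.lt_omega0.1 ha
    exact ⟨n, rfl⟩
  · rintro ⟨n, rfl⟩
    exact ⟨n, Ordinal.natCast_lt_omega0 n, rfl⟩

theorem mem_funCode {f : ℕ → ℕ} {x : ZFSet.{u}} :
    x ∈ funCode f ↔ ∃ n, x = ZFSet.pair (natCode n) (natCode (f n)) := by
  simp [funCode, eq_comm]

theorem pair_natCode_mem_funCode {f : ℕ → ℕ} {n : ℕ} {y : ZFSet.{u}} :
    ZFSet.pair (natCode n) y ∈ funCode f ↔ y = natCode (f n) := by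
  rw [mem_funCode]
  constructor
  · rintro ⟨m, h⟩
    obtain ⟨h₁, rfl⟩ := ZFSet.pair_inj.1 h
    rw [natCode_injective h₁]
  · rintro rfl
    exact ⟨n, rfl⟩

namespace IsInnerModel

variable {V : Set ZFSet.{u}}

theorem natCode_mem (hV : IsInnerModel V) (n : ℕ) : natCode n ∈ V :=
  hV.ordinals _ (ZFSet.isOrdinal_toZFSet _)

theorem omega_mem (hV : IsInnerModel V) : (ω : Ordinal.{u}).toZFSet ∈ V :=
  hV.ordinals _ (ZFSet.isOrdinal_toZFSet _)

/-- Kuratowski pairs of naturals are subsets of the power set of `ω`, so two power sets in `V`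
supply the ambient set that separation needs for every graph. -/
theorem exists_bound_funCode (hV : IsInnerModel V) :
    ∃ B ∈ V, ∀ f : ℕ → ℕ, ∀ x ∈ funCode f, x ∈ B := by
  obtain ⟨b, hb, hb'⟩ := hV.exists_powerset hV.omega_mem
  obtain ⟨B, hB, hB'⟩ := hV.exists_powerset hb
  refine ⟨B, hB, fun f x hx => ?_⟩
  obtain ⟨n, rfl⟩ := mem_funCode.1 hx
  refine hB' _ (hV.pair_mem (hV.natCode_mem _) (hV.natCode_mem _)) fun z hz => ?_
  have hω : ∀ m : ℕ, natCode m ∈ (ω : Ordinal.{u}).toZFSet := fun m => mem_omega_toZFSet.2 ⟨m, rfl⟩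
  rw [ZFSet.pair, ← ZFSet.pair_eq_singleton, ZFSet.mem_pair] at hz
  rcases hz with rfl | rfl
  · refine hb' _ (hV.upair_mem (hV.natCode_mem _) (hV.natCode_mem _)) fun w hw => ?_
    rcases ZFSet.mem_pair.1 hw with rfl | rfl <;> exact hω _
  · refine hb' _ (hV.upair_mem (hV.natCode_mem _) (hV.natCode_mem _)) fun w hw => ?_
    rcases ZFSet.mem_pair.1 hw with rfl | rfl <;> exact hω _

theorem funCode_succ_mem (hV : IsInnerModel V) : funCode Nat.succ ∈ V := by
  obtain ⟨B, hB, hB'⟩ := hV.exists_bound_funCode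
  refine hV.mem_of_definable (n := 1) (P := fun v => ∃ k l : V,
    (k : ZFSet.{u}) ∈ (v 1 : ZFSet.{u}) ∧ (l : ZFSet.{u}) = insert (k : ZFSet.{u}) (k : ZFSet.{u}) ∧
    (v 0 : ZFSet.{u}) = ZFSet.pair k l) ?_ ![⟨_, hV.omega_mem⟩] hB (hB' _) fun x => ?_
  · exact .ex (.ex (.and (.mem _ _) (.and (hV.definable_insert_self _ _)
      (hV.definable_pair _ _ _))))
  · rw [mem_funCode]
    constructor
    · rintro ⟨n, hn⟩
      exact ⟨⟨_, hV.natCode_mem n⟩, ⟨_, hV.natCode_mem (n + 1)⟩, mem_omega_toZFSet.2 ⟨n, rfl⟩,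
        natCode_succ n, hn⟩
    · rintro ⟨k, l, hk, hl, hx⟩
      obtain ⟨n, hn⟩ := mem_omega_toZFSet.1 hk
      refine ⟨n, hx.trans ?_⟩
      rw [hl, hn, Nat.succ_eq_add_one, natCode_succ]

theorem funCode_comp_mem (hV : IsInnerModel V) {f g : ℕ → ℕ} (hf : funCode f ∈ V)
    (hg : funCode g ∈ V) : funCode (f ∘ g) ∈ V := by
  obtain ⟨B, hB, hB'⟩ := hV.exists_bound_funCode
  refine hV.mem_of_definable (n := 2) (P := fun v => ∃ k l m p q : V,
    (p : ZFSet.{u}) = ZFSet.pair k l ∧ (p : ZFSet.{u}) ∈ (v 1 : ZFSet.{u}) ∧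
    (q : ZFSet.{u}) = ZFSet.pair l m ∧ (q : ZFSet.{u}) ∈ (v 2 : ZFSet.{u}) ∧
    (v 0 : ZFSet.{u}) = ZFSet.pair k m) ?_ ![⟨_, hg⟩, ⟨_, hf⟩] hB (hB' _) fun x => ?_
  · exact .ex (.ex (.ex (.ex (.ex (.and (hV.definable_pair _ _ _) (.and (.mem _ _)
      (.and (hV.definable_pair _ _ _) (.and (.mem _ _) (hV.definable_pair _ _ _)))))))))
  · constructor
    · intro hx
      obtain ⟨n, hn⟩ := mem_funCode.1 hx
      exact ⟨⟨_, hV.natCode_mem n⟩, ⟨_, hV.natCode_mem (g n)⟩, ⟨_, hV.natCode_mem (f (g n))⟩,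
        ⟨_, hV.pair_mem (hV.natCode_mem _) (hV.natCode_mem _)⟩,
        ⟨_, hV.pair_mem (hV.natCode_mem _) (hV.natCode_mem _)⟩, rfl,
        mem_funCode.2 ⟨_, rfl⟩, rfl, mem_funCode.2 ⟨_, rfl⟩, hn⟩
    · rintro ⟨k, l, m, p, q, hp, hpg, hq, hqf, hx⟩
      change (p : ZFSet.{u}) ∈ funCode g at hpg
      change (q : ZFSet.{u}) ∈ funCode f at hqf
      change (x : ZFSet.{u}) = _ at hx
      obtain ⟨n, hn⟩ := mem_funCode.1 hpg
      rw [hp] at hn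
      obtain ⟨hk, hl⟩ := ZFSet.pair_inj.1 hn
      rw [hq, hl, pair_natCode_mem_funCode] at hqf
      rw [hx, hk, hqf, pair_natCode_mem_funCode]
      rfl

/-- Finite pieces of a graph need no definability: they are built by finitely many insertions, so
`f` need not be in `V`. -/
theorem exists_initialSegment (hV : IsInnerModel V) (f : ℕ → ℕ) (n : ℕ) :
    ∃ s ∈ V, ∀ x : ZFSet.{u},
      x ∈ s ↔ ∃ i < n, x = ZFSet.pair (natCode i) (natCode (f i)) := by
  induction n with
  | zero =>
    exact ⟨∅, by simpa [natCode_zero] using hV.natCode_mem 0, fun x => by simp⟩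
  | succ n ih =>
    obtain ⟨s, hs, h⟩ := ih
    refine ⟨insert (ZFSet.pair (natCode n) (natCode (f n))) s,
      hV.insert_mem (hV.pair_mem (hV.natCode_mem _) (hV.natCode_mem _)) hs, fun x => ?_⟩
    rw [ZFSet.mem_insert_iff, h]
    constructor
    · rintro (hx | ⟨i, hi, hx⟩)
      · exact ⟨n, by omega, hx⟩
      · exact ⟨i, by omega, hx⟩
    · rintro ⟨i, hi, hx⟩
      rcases Nat.lt_succ_iff_lt_or_eq.1 hi with h | rfl
      · exact Or.inr ⟨i, h, hx⟩
      · exact Or.inl hx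

/-- Recursion inside `V`: a pair is on the graph iff it lies in some set `s` of `V` each of whose
members is the initial pair or arises from another member by one step of `f`. Initial segments of
the graph are such `s`. -/
theorem funCode_iterate_mem (hV : IsInnerModel V) {f : ℕ → ℕ} (hf : funCode f ∈ V) (a : ℕ) :
    funCode (fun n => f^[n] a) ∈ V := by
  obtain ⟨B, hB, hB'⟩ := hV.exists_bound_funCode
  refine hV.mem_of_definable (n := 2) (P := fun v => ∃ s : V,
    (v 0 : ZFSet.{u}) ∈ (s : ZFSet.{u}) ∧ ∀ q : V, (q : ZFSet.{u}) ∈ (s : ZFSet.{u}) →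
      q = v 1 ∨ ∃ k l k' l' p p' : V, (p : ZFSet.{u}) = ZFSet.pair k l ∧
        (p : ZFSet.{u}) ∈ (s : ZFSet.{u}) ∧ (p' : ZFSet.{u}) = ZFSet.pair l l' ∧
        (p' : ZFSet.{u}) ∈ (v 2 : ZFSet.{u}) ∧
        (k' : ZFSet.{u}) = insert (k : ZFSet.{u}) (k : ZFSet.{u}) ∧
        (q : ZFSet.{u}) = ZFSet.pair k' l') ?_
    ![⟨_, hV.pair_mem (hV.natCode_mem 0) (hV.natCode_mem a)⟩, ⟨_, hf⟩] hB (hB' _) fun x => ?_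
  · exact .ex (.and (.mem _ _) (.all (.imp (.mem _ _) (.or (.eq _ _)
      (.ex (.ex (.ex (.ex (.ex (.ex (.and (hV.definable_pair _ _ _) (.and (.mem _ _)
        (.and (hV.definable_pair _ _ _) (.and (.mem _ _) (.and (hV.definable_insert_self _ _)
          (hV.definable_pair _ _ _))))))))))))))))
  · constructor
    · intro hx
      obtain ⟨n, hn⟩ := mem_funCode.1 hx
      obtain ⟨s, hs, h⟩ := hV.exists_initialSegment (fun n => f^[n] a) (n + 1)
      refine ⟨⟨s, hs⟩, (h _).2 ⟨n, by omega, hn⟩, fun q hq => ?_⟩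
      obtain ⟨i, hi, hq⟩ := (h _).1 hq
      rcases i with _ | i
      · exact Or.inl (Subtype.ext hq)
      · right
        refine ⟨⟨_, hV.natCode_mem i⟩, ⟨_, hV.natCode_mem (f^[i] a)⟩, ⟨_, hV.natCode_mem (i + 1)⟩,
          ⟨_, hV.natCode_mem (f^[i + 1] a)⟩,
          ⟨_, hV.pair_mem (hV.natCode_mem _) (hV.natCode_mem _)⟩,
          ⟨_, hV.pair_mem (hV.natCode_mem _) (hV.natCode_mem _)⟩, rfl,
          (h _).2 ⟨i, by omega, rfl⟩, rfl, ?_, natCode_succ i, hq⟩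
        exact pair_natCode_mem_funCode.2 (by rw [Function.iterate_succ_apply'])
    · rintro ⟨s, hxs, hs⟩
      -- The set `s` need not be a function or be finite; ∈-induction on the first coordinate still
      -- puts all its pairs on the graph, since a step passes from `k` to `k ∪ {k}`.
      have key : ∀ k : ZFSet.{u}, ∀ l, ZFSet.pair k l ∈ (s : ZFSet.{u}) →
          ZFSet.pair k l ∈ funCode fun n => f^[n] a := by
        intro k
        induction k using ZFSet.inductionOn with
        | h k ih =>
          intro l hkl
          rcases hs ⟨_, hV.transitive _ s.2 _ hkl⟩ hkl with h | ⟨i, j, i', j', p, p', hp, hps, hp', hpf, hi, h⟩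
          · have h : ZFSet.pair k l = ZFSet.pair (natCode 0) (natCode a) := congrArg Subtype.val h
            exact mem_funCode.2 ⟨0, h⟩
          · change (p' : ZFSet.{u}) ∈ funCode f at hpf
            change ZFSet.pair k l = _ at h
            obtain ⟨rfl, rfl⟩ := ZFSet.pair_inj.1 h
            rw [hp] at hps
            obtain ⟨n, hn⟩ := mem_funCode.1 (ih i (by rw [hi]; exact ZFSet.mem_insert _ _) j hps)
            obtain ⟨hi₀, hj₀⟩ := ZFSet.pair_inj.1 hn
            rw [hp', hj₀, pair_natCode_mem_funCode] at hpf
            refine mem_funCode.2 ⟨n + 1, ?_⟩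
            rw [hi, hi₀, hpf, natCode_succ, Function.iterate_succ_apply']
      change (x : ZFSet.{u}) ∈ (s : ZFSet.{u}) at hxs
      rcases hs x hxs with h | ⟨i, j, i', j', p, p', -, -, -, -, -, h⟩
      · have h : (x : ZFSet.{u}) = ZFSet.pair (natCode 0) (natCode a) := congrArg Subtype.val h
        exact mem_funCode.2 ⟨0, h⟩
      · rw [h] at hxs ⊢
        exact key _ _ hxs

theorem funCode_two_pow_mem (hV : IsInnerModel V) : funCode (fun n => 2 ^ n) ∈ V := by
  have h₂ : funCode (fun n => 2 * n) ∈ V := by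
    convert hV.funCode_iterate_mem (hV.funCode_comp_mem hV.funCode_succ_mem hV.funCode_succ_mem) 0
      using 2
    funext n
    induction n with
    | zero => rfl
    | succ n ih =>
      rw [Function.iterate_succ_apply', ← ih]
      rfl
  convert hV.funCode_iterate_mem h₂ 1 using 2
  funext n
  induction n with
  | zero => rfl
  | succ n ih => rw [Function.iterate_succ_apply', ← ih, pow_succ']

end IsInnerModel

/-! ### The guessing principles -/

theorem DiamondMinusLP.daggerLP {V : Set ZFSet.{u}} (h : DiamondMinusLP V) : DaggerLP V :=
  fun w hw => by
    obtain ⟨g, hg, hg'⟩ := h w hw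
    exact ⟨g, hg, fun r hr => (hg' r hr).nonempty⟩

/-- The finite ordinals as elements of `ω₁`. -/
noncomputable def natOmegaOne (k : ℕ) : OmegaOne.{u} :=
  ⟨k, (Ordinal.natCast_lt_omega0 k).trans Ordinal.omega0_lt_omega_one⟩

theorem natOmegaOne_injective : Function.Injective natOmegaOne.{u} := fun _ _ h =>
  Nat.cast_injective (congrArg Subtype.val h)

/-- The `k`-th bit of `x` is defined and equal to `1`. -/
def HasBit {α : OmegaOne.{u}} (x : Set.Iio α → Bool) (k : ℕ) : Prop :=
  ∃ h : natOmegaOne k < α, x ⟨natOmegaOne k, h⟩ = true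

open Classical in
/-- The function whose graph is coded by the first `ω` bits of `x`. -/
noncomputable def decodeBits (α : OmegaOne.{u}) (x : Set.Iio α → Bool) (n : ℕ) : ℕ :=
  -- The second disjunct gives the default value 0 when no bit of row `n` is set.
  Nat.find (p := fun k => HasBit x (Nat.pair n k) ∨ ∀ j, ¬ HasBit x (Nat.pair n j)) (by
    by_cases h : ∃ j, HasBit x (Nat.pair n j)
    · obtain ⟨j, hj⟩ := h
      exact ⟨j, Or.inl hj⟩
    · exact ⟨0, Or.inr fun j hj => h ⟨j, hj⟩⟩)

theorem isBorelMap_decodeBits : IsBorelMap decodeBits.{u} := by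
  classical
  intro α
  rw [← BorelSpace.measurable_eq (α := ℕ → ℕ)]
  let : MeasurableSpace (Set.Iio α → Bool) := borel _
  have : BorelSpace (Set.Iio α → Bool) := ⟨rfl⟩
  have hbit : ∀ k, MeasurableSet {x : Set.Iio α → Bool | HasBit x k} := by
    intro k
    by_cases h : natOmegaOne k < α
    · have : {x : Set.Iio α → Bool | HasBit x k} =
          (fun x => x ⟨natOmegaOne k, h⟩) ⁻¹' {true} := by
        ext x
        simp [HasBit, h]
      rw [this]
      exact ((isOpen_discrete _).preimage (continuous_apply _)).measurableSet
    · simp [HasBit, h]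
  refine measurable_pi_iff.2 fun n => measurable_find _ fun k => ?_
  have hnone : MeasurableSet {x : Set.Iio α → Bool | ∀ j, ¬ HasBit x (Nat.pair n j)} := by
    rw [Set.ofPred_forall]
    exact MeasurableSet.iInter fun j => (hbit _).compl
  exact (hbit _).union hnone

theorem decodeBits_eq {α : OmegaOne.{u}} (hα : ∀ k, natOmegaOne k < α) {x : Set.Iio α → Bool}
    {r : ℕ → ℕ} (hx : ∀ n k, x ⟨natOmegaOne (Nat.pair n k), hα _⟩ = true ↔ k = r n) :
    decodeBits α x = r := by
  classical
  have hbit : ∀ n k, HasBit x (Nat.pair n k) ↔ k = r n := fun n k => by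
    simp [HasBit, hα, hx]
  funext n
  simp only [decodeBits, hbit, Nat.find_eq_iff]
  refine ⟨by simp, fun m hm h => ?_⟩
  rcases h with h | h
  · exact hm.ne h
  · exact h _ rfl

/-- A real is written into the first `ω` bits of a branch and read back by the Borel map
`decodeBits`. -/
theorem DiamondLP.daggerLP {V : Set ZFSet.{u}} (h : DiamondLP V) : DaggerLP V := fun w hw => by
  classical
  obtain ⟨g, hg, hg'⟩ := h decodeBits isBorelMap_decodeBits w hw
  refine ⟨g, hg, fun r hr => ?_⟩
  let f : OmegaOne.{u} → Bool := fun ξ => decide (∃ n, ξ = natOmegaOne (Nat.pair n (r n)))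
  let o : OmegaOne.{u} := ⟨ω, Ordinal.omega0_lt_omega_one⟩
  -- Only for `α ≥ ω` is the whole code visible below `α`; these `α` form a club, which the
  -- stationary set meets.
  have hclub : IsClub (Set.Ici o) := by
    refine ⟨fun d hd hne _ a ha => ?_, fun a => ⟨max a o, Set.mem_Ici.2 (le_max_right _ _), le_max_left _ _⟩⟩
    obtain ⟨b, hb⟩ := hne
    exact (hd hb).trans (ha.1 hb)
  obtain ⟨α, hα, hoα⟩ := hg' f hclub
  have hdec : decodeBits α (fun ξ => f ξ.1) = r := by
    refine decodeBits_eq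
      (fun k => lt_of_lt_of_le (show natOmegaOne k < o from Ordinal.natCast_lt_omega0 k) hoα)
      fun n k => ?_
    simp only [f, decide_eq_true_eq, natOmegaOne_injective.eq_iff, Nat.pair_eq_pair]
    constructor
    · rintro ⟨m, rfl, rfl⟩
      rfl
    · rintro rfl
      exact ⟨n, rfl, rfl⟩
  change IsBoundedOver V (decodeBits α fun ξ => f ξ.1) →
    Captures (g α) (decodeBits α fun ξ => f ξ.1) at hα
  rw [hdec] at hα
  exact ⟨α, hα hr⟩

/-- The truncation of `A` to the numbers below `2 ^ 2 ^ (n + 1)`. -/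
noncomputable def truncation (A : Set ℕ) (n : ℕ) : Finset ℕ :=
  open Classical in (Finset.range (2 ^ 2 ^ (n + 1))).filter (· ∈ A)

/-- Under `†(LP_V)`, all sets of natural numbers are captured by `ω₁` many thin sequences of finite
families. -/
theorem DaggerLP.exists_guessing {V : Set ZFSet.{u}} (h : DaggerLP V) (hV : IsInnerModel V) :
    ∃ C : OmegaOne.{u} → ℕ → Finset (Finset ℕ), (∀ α n, (C α n).card ≤ n + 1) ∧
      ∀ A : Set ℕ, ∃ α, ∀ n, truncation A n ∈ C α n := by
  classical
  obtain ⟨g, hg, hg'⟩ := h (fun _ => Nat.succ) fun α =>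
    ⟨⟨Nat.succ_ne_zero, Filter.tendsto_add_atTop_nat 1⟩, hV.funCode_succ_mem⟩
  refine ⟨fun α n => (g α n).image fun σ => (σ (Fin.last n)).bitIndices.toFinset, fun α n => ?_,
    fun A => ?_⟩
  · exact Finset.card_image_le.trans (congrFun (hg α).2.2 n).le
  · let r : ℕ → ℕ := fun n => ∑ i ∈ truncation A n, 2 ^ i
    have hr : IsBoundedOver V r := by
      refine ⟨(fun n => 2 ^ n) ∘ (fun n => 2 ^ n) ∘ (fun n => 2 ^ n) ∘ Nat.succ,
        hV.funCode_comp_mem hV.funCode_two_pow_mem (hV.funCode_comp_mem hV.funCode_two_pow_mem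
          (hV.funCode_comp_mem hV.funCode_two_pow_mem hV.funCode_succ_mem)), fun n => ?_⟩
      refine (Nat.geomSum_lt le_rfl fun k hk => ?_).le
      simpa using (Finset.mem_filter.1 hk).1
    obtain ⟨α, hα⟩ := hg' r hr
    exact ⟨α, fun n => Finset.mem_image.2 ⟨_, hα n, by simp [r]⟩⟩

/-! ### Coherent sequences of involutions -/

/-- If `P k` holds from `N k` on, let `κ n` be the greatest `k ≤ n` with `N k ≤ n`. -/
theorem exists_diagonal_of_forall_eventually {P : ℕ → ℕ → Prop}
    (h : ∀ k, ∀ᶠ n in Filter.atTop, P k n) :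
    ∃ κ : ℕ → ℕ, Filter.Tendsto κ Filter.atTop Filter.atTop ∧
      ∀ᶠ n in Filter.atTop, P (κ n) n := by
  classical
  simp only [Filter.eventually_atTop] at h
  choose N hN using h
  refine ⟨fun n => Nat.findGreatest (fun k => N k ≤ n) n, ?_, ?_⟩
  · refine Filter.tendsto_atTop.2 fun k => ?_
    filter_upwards [Filter.eventually_ge_atTop (max k (N k))] with n hn
    exact Nat.le_findGreatest (le_trans (le_max_left _ _) hn) (le_trans (le_max_right _ _) hn)
  · filter_upwards [Filter.eventually_ge_atTop (N 0)] with n hn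
    exact hN _ _ (Nat.findGreatest_spec (P := fun k => N k ≤ n) (Nat.zero_le n) hn)

/-- Transfinite recursion with choice. Since `R γ α` sees `f` only up to `γ`, the part of `f`
already built can be filled up with arbitrary values from `α` on. -/
theorem exists_of_forall_exists_extension {W X : Type*} [LinearOrder W] [WellFoundedLT W]
    [Nonempty X] (I : X → Prop) (R : W → W → (W → X) → X → Prop)
    (hR : ∀ γ α f f' x, (∀ β ≤ γ, f β = f' β) → R γ α f x → R γ α f' x)
    (h : ∀ α (f : W → X), (∀ γ < α, I (f γ)) → (∀ γ < α, ∀ β < γ, R β γ f (f γ)) →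
      ∃ x, I x ∧ ∀ γ < α, R γ α f x) :
    ∃ f : W → X, (∀ α, I (f α)) ∧ ∀ α, ∀ γ < α, R γ α f (f α) := by
  classical
  let extend (α : W) (g : (γ : W) → γ < α → X) (γ : W) : X :=
    if hγ : γ < α then g γ hγ else Classical.arbitrary X
  let f : W → X := (wellFounded_lt (α := W)).fix fun α g =>
    Classical.epsilon fun x => I x ∧ ∀ γ < α, R γ α (extend α g) x
  have hf : ∀ α, f α = Classical.epsilon fun x =>
      I x ∧ ∀ γ < α, R γ α (extend α fun γ _ => f γ) x := fun α =>
    (wellFounded_lt (α := W)).fix_eq _ α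
  have hext : ∀ α γ, γ < α → extend α (fun γ _ => f γ) γ = f γ := fun α γ hγ => dif_pos hγ
  have key : ∀ α, I (f α) ∧ ∀ γ < α, R γ α f (f α) := by
    intro α
    induction α using WellFoundedLT.induction with
    | ind α ih =>
      obtain ⟨x, hx, hxR⟩ := h α f (fun γ hγ => (ih γ hγ).1) fun γ hγ => (ih γ hγ).2
      have hspec := Classical.epsilon_spec
        (p := fun x => I x ∧ ∀ γ < α, R γ α (extend α fun γ _ => f γ) x)
        ⟨x, hx, fun γ hγ => hR γ α f _ x
          (fun β hβ => (hext α β (hβ.trans_lt hγ)).symm) (hxR γ hγ)⟩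
      rw [← hf] at hspec
      exact ⟨hspec.1, fun γ hγ => hR γ α _ f _ (fun β hβ => hext α β (hβ.trans_lt hγ))
        (hspec.2 γ hγ)⟩
  exact ⟨f, fun α => (key α).1, fun α => (key α).2⟩

/-- `φ` restricts to an involution of `L`. -/
def IsInvolutionOn (L : Finset ℕ) (φ : ℕ → ℕ) : Prop := ∀ x ∈ L, φ x ∈ L ∧ φ (φ x) = x

/-- On `L`, the function `ψ` agrees with `φ` wherever `φ` moves a point. -/
def ExtendsOn (L : Finset ℕ) (φ ψ : ℕ → ℕ) : Prop := ∀ x ∈ L, φ x ≠ x → ψ x = φ x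

/-- No member of `T` separates a point of `L` fixed by `φ` from its image under `ψ`. -/
def RespectsOn (L : Finset ℕ) (T : Finset (Finset ℕ)) (φ ψ : ℕ → ℕ) : Prop :=
  ∀ x ∈ L, φ x = x → ∀ s ∈ T, x ∈ s ↔ ψ x ∈ s

/-- The points of `L` moved by `φ`. -/
def movedIn (L : Finset ℕ) (φ : ℕ → ℕ) : Finset ℕ := L.filter fun x => φ x ≠ x

theorem ExtendsOn.refl (L : Finset ℕ) (φ : ℕ → ℕ) : ExtendsOn L φ φ := fun _ _ _ => rfl

theorem ExtendsOn.trans {L : Finset ℕ} {φ ψ χ : ℕ → ℕ} (h : ExtendsOn L φ ψ)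
    (h' : ExtendsOn L ψ χ) : ExtendsOn L φ χ := fun x hx hφ => by
  have hψ := h x hx hφ
  rw [h' x hx (by rwa [hψ]), hψ]

theorem ExtendsOn.fixed {L : Finset ℕ} {φ ψ : ℕ → ℕ} (h : ExtendsOn L φ ψ) {x : ℕ} (hx : x ∈ L)
    (hψ : ψ x = x) : φ x = x := by
  by_contra hφ
  exact hφ ((h x hx hφ).symm.trans hψ)

theorem RespectsOn.refl (L : Finset ℕ) (T : Finset (Finset ℕ)) (φ : ℕ → ℕ) :
    RespectsOn L T φ φ := fun x _ hφ s _ => by rw [hφ]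

/-- A point fixed by `φ` is either still fixed by `ψ`, or already moved by `ψ`, and then `χ` agrees
with `ψ` there. -/
theorem RespectsOn.trans {L : Finset ℕ} {T : Finset (Finset ℕ)} {φ ψ χ : ℕ → ℕ}
    (h : RespectsOn L T φ ψ) (h' : RespectsOn L T ψ χ) (hχ : ExtendsOn L ψ χ) :
    RespectsOn L T φ χ := fun x hx hφ s hs => by
  by_cases hψ : ψ x = x
  · exact h' x hx hψ s hs
  · rw [hχ x hx hψ]
    exact h x hx hφ s hs

/-- More than `2 ^ T.card` points are fixed, so two of them lie in the same members of `T`;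
composing `φ` with their transposition adds just this pair. -/
theorem exists_involution_extending {L : Finset ℕ} {φ : ℕ → ℕ} (hφ : IsInvolutionOn L φ)
    (T : Finset (Finset ℕ)) (hcard : (movedIn L φ).card + 2 ^ T.card < L.card) :
    ∃ ψ, IsInvolutionOn L ψ ∧ ExtendsOn L φ ψ ∧ (∃ x ∈ L, φ x = x ∧ ψ x ≠ x) ∧
      RespectsOn L T φ ψ ∧ (movedIn L ψ).card ≤ (movedIn L φ).card + 2 := by
  classical
  have hfix : T.powerset.card < (L.filter fun x => φ x = x).card := by
    have := Finset.card_filter_add_card_filter_not (s := L) (fun x => φ x = x)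
    rw [Finset.card_powerset]
    simp only [movedIn, ne_eq] at hcard
    omega
  obtain ⟨x, hx, y, hy, hxy, hT⟩ := Finset.exists_ne_map_eq_of_card_lt_of_maps_to hfix
    (f := fun x => T.filter fun s => x ∈ s) fun x _ => Finset.mem_coe.2 (by simp)
  rw [Finset.mem_filter] at hx hy
  have hT' : ∀ s ∈ T, x ∈ s ↔ y ∈ s := fun s hs => by
    have := congrArg (s ∈ ·) hT
    simpa [hs] using this
  have hne : ∀ z ∈ L, z ≠ x → z ≠ y → φ z ≠ x ∧ φ z ≠ y := by
    intro z hz hzx hzy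
    constructor
    · intro h
      have := (hφ z hz).2
      rw [h, hx.2] at this
      exact hzx this.symm
    · intro h
      have := (hφ z hz).2
      rw [h, hy.2] at this
      exact hzy this.symm
  have hψx : Equiv.swap x y (φ x) = y := by rw [hx.2, Equiv.swap_apply_left]
  have hψy : Equiv.swap x y (φ y) = x := by rw [hy.2, Equiv.swap_apply_right]
  have hψz : ∀ z ∈ L, z ≠ x → z ≠ y → Equiv.swap x y (φ z) = φ z := fun z hz hzx hzy =>
    Equiv.swap_apply_of_ne_of_ne (hne z hz hzx hzy).1 (hne z hz hzx hzy).2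
  refine ⟨fun z => Equiv.swap x y (φ z), ?_, ?_, ⟨x, hx.1, hx.2, ?_⟩, ?_, ?_⟩
  · intro z hz
    by_cases hzx : z = x
    · simp only [hzx, hψx, hψy, hy.1, and_self]
    by_cases hzy : z = y
    · simp only [hzy, hψx, hψy, hx.1, and_self]
    have hn := hne z hz hzx hzy
    have hz' := hφ z hz
    simp only [hψz z hz hzx hzy, hψz (φ z) hz'.1 hn.1 hn.2]
    exact hz'
  · intro z hz hzφ
    exact hψz z hz (fun h => hzφ (h ▸ hx.2)) fun h => hzφ (h ▸ hy.2)
  · simpa only [hψx] using hxy.symm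
  · intro z hz hzφ s hs
    by_cases hzx : z = x
    · subst hzx
      simp only [hψx]
      exact hT' s hs
    by_cases hzy : z = y
    · subst hzy
      simp only [hψy]
      exact (hT' s hs).symm
    simp only [hψz z hz hzx hzy]
    rw [hzφ]
  · have hsub : movedIn L (fun z => Equiv.swap x y (φ z)) ⊆ movedIn L φ ∪ {x, y} := by
      intro z hz
      simp only [movedIn, Finset.mem_filter, Finset.mem_union, Finset.mem_insert,
        Finset.mem_singleton] at hz ⊢
      by_cases hzx : z = x
      · exact Or.inr (Or.inl hzx)
      by_cases hzy : z = y
      · exact Or.inr (Or.inr hzy)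
      rw [hψz z hz.1 hzx hzy] at hz
      exact Or.inl hz
    exact (Finset.card_le_card hsub).trans ((Finset.card_union_le _ _).trans
      (Nat.add_le_add_left Finset.card_le_two _))

/-! ### One step of the recursion, and the coherent sequence -/

section Coherent

variable {W : Type*} [LinearOrder W] (L : ℕ → Finset ℕ) (C : W → ℕ → Finset (Finset ℕ))

/-- The involutions, given level by level, that move few points of each level. -/
def IsThinInvolution (φ : ℕ → ℕ → ℕ) : Prop :=
  (∀ n, IsInvolutionOn (L n) (φ n)) ∧
    ∀ k, ∀ᶠ n in Filter.atTop, (movedIn (L n) (φ n)).card + k ≤ n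

/-- On almost all levels `ψ` properly extends `φ`, and the new part respects every set guessed
before `γ`. -/
def IsGuidedExtension (γ : W) (φ ψ : ℕ → ℕ → ℕ) : Prop :=
  (∀ᶠ n in Filter.atTop, ExtendsOn (L n) (φ n) (ψ n)) ∧
    (∀ᶠ n in Filter.atTop, ∃ x ∈ L n, φ n x = x ∧ ψ n x ≠ x) ∧
    ∀ β ≤ γ, ∀ᶠ n in Filter.atTop, RespectsOn (L n) (C β n) (φ n) (ψ n)

variable {L C}

theorem exists_common_guidedExtension
    (hL : ∀ k, ∀ᶠ n in Filter.atTop, n + 2 ^ (k * (n + 1)) < (L n).card)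
    (hC : ∀ α n, (C α n).card ≤ n + 1) {α : W} (hα : (Set.Iio α).Countable) (f : W → ℕ → ℕ → ℕ)
    (hf : ∀ γ < α, IsThinInvolution L (f γ))
    (hff : ∀ γ < α, ∀ β < γ, IsGuidedExtension L C β (f β) (f γ)) :
    ∃ ψ, IsThinInvolution L ψ ∧ ∀ γ < α, IsGuidedExtension L C γ (f γ) ψ := by
  classical
  rcases (Set.Iio α).eq_empty_or_nonempty with hempty | hne
  · refine ⟨fun _ x => x, ⟨fun n x hx => ⟨hx, rfl⟩, fun k => ?_⟩, fun γ hγ => ?_⟩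
    · filter_upwards [Filter.eventually_ge_atTop k] with n hn
      simpa [movedIn] using hn
    · exact absurd (show γ ∈ Set.Iio α from hγ) (by simp [hempty])
  obtain ⟨e, he⟩ := hα.exists_eq_range hne
  have heα : ∀ k, e k < α := fun k => show e k ∈ Set.Iio α from he ▸ Set.mem_range_self k
  -- `g k` is the maximum of `e 0, …, e k`: a single earlier involution that almost extends all of
  -- theirs.
  have hbound : ∀ k, ∃ γ < α, ∀ j ≤ k, e j ≤ γ := fun k => by
    refine ⟨(Finset.range (k + 1)).sup' ⟨0, by simp⟩ e, ?_, fun j hj => ?_⟩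
    · exact (Finset.sup'_lt_iff _).2 fun j _ => heα j
    · exact Finset.le_sup' e (by simpa [Nat.lt_succ_iff] using hj)
  choose g hgα hg using hbound
  have hfin : ∀ (k : ℕ) (p : ℕ → ℕ → Prop), (∀ j ≤ k, ∀ᶠ n in Filter.atTop, p j n) →
      ∀ᶠ n in Filter.atTop, ∀ j ≤ k, p j n := fun k p h =>
    (Filter.eventually_all_finite (Set.finite_Iic k)).2 h
  -- The summand 2 pays for the pair to be added, leaving slack `k`. The exponent `(k + 1) * (n +
  -- 1)` bounds the number of sets in `k + 1` families.
  have hP : ∀ k, ∀ᶠ n in Filter.atTop,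
      (∀ j ≤ k, ExtendsOn (L n) (f (e j) n) (f (g k) n)) ∧
      (∀ i ≤ k, ∀ j ≤ k, e i ≤ e j → RespectsOn (L n) (C (e i) n) (f (e j) n) (f (g k) n)) ∧
      (movedIn (L n) (f (g k) n)).card + (k + 2) ≤ n ∧
      n + 2 ^ ((k + 1) * (n + 1)) < (L n).card := by
    intro k
    refine (hfin k _ fun j hj => ?_).and ((hfin k _ fun i hi => hfin k _ fun j hj => ?_).and
      (((hf _ (hgα k)).2 (k + 2)).and (hL (k + 1))))
    · rcases (hg k j hj).eq_or_lt with h | h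
      · rw [h]
        exact .of_forall fun n => .refl _ _
      · exact (hff _ (hgα k) _ h).1
    · rw [Filter.eventually_imp_distrib_left]
      intro hij
      rcases (hg k j hj).eq_or_lt with h | h
      · rw [h]
        exact .of_forall fun n => .refl _ _ _
      · exact (hff _ (hgα k) _ h).2.2 _ hij
  obtain ⟨κ, hκ, hκP⟩ := exists_diagonal_of_forall_eventually hP
  let T (n : ℕ) : Finset (Finset ℕ) := (Finset.range (κ n + 1)).biUnion fun i => C (e i) n
  have hT : ∀ n, (T n).card ≤ (κ n + 1) * (n + 1) := fun n => by
    simpa using Finset.card_biUnion_le_card_mul (Finset.range (κ n + 1)) (fun i => C (e i) n)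
      (n + 1) fun i _ => hC _ _
  -- On the finitely many blocks too small for the pigeonhole argument, the identity is used.
  have hψ : ∀ n, ∃ ψ, IsInvolutionOn (L n) ψ ∧
      ((movedIn (L n) (f (g (κ n)) n)).card + 2 ^ (T n).card < (L n).card →
        ExtendsOn (L n) (f (g (κ n)) n) ψ ∧ (∃ x ∈ L n, f (g (κ n)) n x = x ∧ ψ x ≠ x) ∧
        RespectsOn (L n) (T n) (f (g (κ n)) n) ψ ∧
        (movedIn (L n) ψ).card ≤ (movedIn (L n) (f (g (κ n)) n)).card + 2) := by
    intro n
    by_cases h : (movedIn (L n) (f (g (κ n)) n)).card + 2 ^ (T n).card < (L n).card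
    · obtain ⟨ψ, h₁, h₂⟩ := exists_involution_extending ((hf _ (hgα (κ n))).1 n) (T n) h
      exact ⟨ψ, h₁, fun _ => h₂⟩
    · exact ⟨fun x => x, fun x hx => ⟨hx, rfl⟩, fun h' => absurd h' h⟩
  choose ψ hψinv hψ using hψ
  have hcard : ∀ᶠ n in Filter.atTop,
      (movedIn (L n) (f (g (κ n)) n)).card + 2 ^ (T n).card < (L n).card := by
    filter_upwards [hκP] with n hn
    have := Nat.pow_le_pow_right (n := 2) (by norm_num) (hT n)
    omega
  refine ⟨ψ, ⟨hψinv, fun k => ?_⟩, fun γ hγ => ?_⟩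
  · filter_upwards [hκP, hcard, hκ.eventually_ge_atTop k] with n hn hc hk
    have := (hψ n hc).2.2.2
    omega
  · obtain ⟨j, rfl⟩ : γ ∈ Set.range e := he ▸ hγ
    refine ⟨?_, ?_, fun β hβ => ?_⟩
    · filter_upwards [hκP, hcard, hκ.eventually_ge_atTop j] with n hn hc hj
      exact (hn.1 j hj).trans (hψ n hc).1
    · filter_upwards [hκP, hcard, hκ.eventually_ge_atTop j] with n hn hc hj
      obtain ⟨x, hx, hfx, hψx⟩ := (hψ n hc).2.1
      exact ⟨x, hx, (hn.1 j hj).fixed hx hfx, hψx⟩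
    · obtain ⟨i, rfl⟩ : β ∈ Set.range e := he ▸ hβ.trans_lt hγ
      filter_upwards [hκP, hcard, hκ.eventually_ge_atTop j, hκ.eventually_ge_atTop i]
        with n hn hc hj hi
      refine (hn.2.1 i hi j hj hβ).trans (fun x hx hfx s hs => ?_) (hψ n hc).1
      exact (hψ n hc).2.2.1 x hx hfx s
        (Finset.mem_biUnion.2 ⟨i, Finset.mem_range.2 (Nat.lt_succ_of_le hi), hs⟩)

theorem exists_coherent_involutions [WellFoundedLT W]
    (hL : ∀ k, ∀ᶠ n in Filter.atTop, n + 2 ^ (k * (n + 1)) < (L n).card)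
    (hC : ∀ α n, (C α n).card ≤ n + 1) (hW : ∀ α : W, (Set.Iio α).Countable) :
    ∃ f : W → ℕ → ℕ → ℕ, (∀ α, IsThinInvolution L (f α)) ∧
      ∀ α, ∀ γ < α, IsGuidedExtension L C γ (f γ) (f α) := by
  refine exists_of_forall_exists_extension (IsThinInvolution L)
    (fun γ _ f ψ => IsGuidedExtension L C γ (f γ) ψ) (fun γ _ f f' ψ h hψ => ?_)
    fun α f hf hff => exists_common_guidedExtension hL hC (hW α) f hf hff
  rwa [← h γ le_rfl]

end Coherent

/-! ### Guided sequences of involutions, bowties and automorphisms -/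

/-- A sequence of involutions of `ω` whose supports are strictly increasing modulo finite sets,
which is coherent modulo finite sets, and whose tails preserve every subset of `ω` modulo finite
sets. -/
structure IsGuidedSequence {W : Type*} [LinearOrder W] (F : W → ℕ → ℕ) : Prop where
  involutive : ∀ α, Function.Involutive (F α)
  coherent : ∀ α β, α ≤ β → {x | F α x ≠ x ∧ F β x ≠ F α x}.Finite
  increasing : ∀ α β, α < β → {x | F α x = x ∧ F β x ≠ x}.Infinite
  invariant : ∀ A : Set ℕ, ∃ δ, ∀ α, δ ≤ α → {x | F δ x = x ∧ ¬ (x ∈ A ↔ F α x ∈ A)}.Finite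

theorem almostEq_image_of_involutive {g : ℕ → ℕ} (hg : Function.Involutive g) {S : Set ℕ}
    (h : {x | x ∈ S ∧ g x ∉ S}.Finite) : AlmostEq (g '' S) S := by
  refine almostEq_iff.2 ⟨(h.image g).subset ?_, h.subset ?_⟩
  · rintro _ ⟨⟨x, hx, rfl⟩, hgx⟩
    exact ⟨x, ⟨hx, hgx⟩, rfl⟩
  · rintro x ⟨hx, hgx⟩
    exact ⟨hx, fun h => hgx ⟨g x, h, hg x⟩⟩

/-- Points are chosen greedily: by injectivity, each earlier point excludes only finitely many later
ones. -/
theorem exists_infinite_separated {E : Set ℕ} (hE : E.Infinite) {e g : ℕ → ℕ} (he : E.InjOn e)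
    (hg : E.InjOn g) (heg : ∀ x ∈ E, e x ≠ g x) :
    ∃ A ⊆ E, A.Infinite ∧ ∀ x ∈ A, ∀ y ∈ A, e x ≠ g y := by
  have hpre : ∀ f : ℕ → ℕ, E.InjOn f → ∀ T : Set ℕ, T.Finite → (E ∩ f ⁻¹' T).Finite :=
    fun f hf T hT => Set.Finite.of_finite_image
      (hT.subset (Set.image_subset_iff.2 Set.inter_subset_right)) (hf.mono Set.inter_subset_left)
  obtain ⟨a, haE, ha⟩ := exists_seq_of_forall_finset_exists (· ∈ E)
    (fun x y => x ≠ y ∧ e x ≠ g y ∧ e y ≠ g x) fun s _ => by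
      have hfin := (s.finite_toSet.union (hpre e he _ (s.finite_toSet.image g))).union
        (hpre g hg _ (s.finite_toSet.image e))
      obtain ⟨y, hy, hys⟩ := hE.exists_notMem_finite hfin
      refine ⟨y, hy, fun x hx => ⟨?_, ?_, ?_⟩⟩
      · rintro rfl
        exact hys (Or.inl (Or.inl hx))
      · exact fun h => hys (Or.inr ⟨hy, x, hx, h⟩)
      · exact fun h => hys (Or.inl (Or.inr ⟨hy, x, hx, h.symm⟩))
  refine ⟨Set.range a, Set.range_subset_iff.2 haE, Set.infinite_range_of_injective ?_, ?_⟩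
  · intro m n hmn
    rcases lt_trichotomy m n with h | h | h
    · exact absurd hmn (ha m n h).1
    · exact h
    · exact absurd hmn.symm (ha n m h).1
  · rintro _ ⟨m, rfl⟩ _ ⟨n, rfl⟩
    rcases lt_trichotomy m n with h | rfl | h
    · exact (ha m n h).2.1
    · exact heg _ (haE m)
    · exact (ha n m h).2.2

namespace IsGuidedSequence

variable {W : Type*} [LinearOrder W] {F : W → ℕ → ℕ}

theorem almostEq_image (hF : IsGuidedSequence F) {δ α : W} (hδ : δ ≤ α) {A : Set ℕ}
    (hA : {x | F δ x = x ∧ ¬ (x ∈ A ↔ F α x ∈ A)}.Finite) :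
    AlmostEq (F α '' (({x | F α x ≠ x} \ {x | F δ x ≠ x}) ∩ A))
      (({x | F α x ≠ x} \ {x | F δ x ≠ x}) ∩ A) := by
  refine almostEq_image_of_involutive (hF.involutive α)
    ((hA.union ((hF.coherent δ α hδ).image (F α))).subset ?_)
  rintro x ⟨⟨⟨hαx, hδx⟩, hxA⟩, hx⟩
  have hδx : F δ x = x := not_not.1 hδx
  have hαx : F α x ≠ x := hαx
  -- If `F α x` falls into the support of `F δ`, then `F α` and `F δ` disagree at it, as otherwise
  -- `F δ` would move `x`; coherence allows finitely many such points.
  by_cases hfix : F δ (F α x) = F α x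
  · refine Or.inl ⟨hδx, fun h => hx ⟨⟨?_, not_not.2 hfix⟩, h.1 hxA⟩⟩
    change F α (F α x) ≠ F α x
    rw [hF.involutive α x]
    exact hαx.symm
  · refine Or.inr ⟨F α x, ⟨hfix, fun h => ?_⟩, hF.involutive α x⟩
    rw [hF.involutive α x] at h
    have h' := congrArg (F δ) h
    rw [hF.involutive δ, hδx] at h'
    exact hαx h'.symm

theorem isBowtieOfInvolutions {F : OmegaOne.{u} → ℕ → ℕ} (hF : IsGuidedSequence F) :
    IsBowtieOfInvolutions (fun α => {x | F α x ≠ x}) F := by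
  have hmaps : ∀ α, Set.MapsTo (F α) {x | F α x ≠ x} {x | F α x ≠ x} := fun α x hx => by
    change F α (F α x) ≠ F α x
    rw [hF.involutive α x]
    exact Ne.symm hx
  refine ⟨⟨fun α => ⟨hmaps α, (hF.involutive α).injective.injOn, fun x hx =>
    ⟨F α x, hmaps α hx, hF.involutive α x⟩⟩, fun α x hx => hx, fun α β h => ⟨?_, ?_⟩,
    fun α β h => ⟨?_, ?_⟩, fun A => ?_⟩, fun α x _ => hF.involutive α x⟩
  · refine (hF.coherent α β h.le).subset ?_
    rintro x ⟨hx, hx'⟩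
    exact ⟨hx, fun h => hx (h.symm.trans (not_not.1 hx'))⟩
  · refine (hF.increasing α β h).mono ?_
    rintro x ⟨hx, hx'⟩
    exact ⟨hx', not_not.2 hx⟩
  · refine almostEq_iff.2 ⟨(hF.coherent α β h).subset ?_, Set.finite_empty.subset ?_⟩
    · rintro x ⟨hx, hx'⟩
      exact ⟨hx, fun h => hx' ⟨fun h' => hx (h.symm.trans h'), hx⟩⟩
    · rintro x ⟨hx, hx'⟩
      exact hx' hx.2
  · refine almostEq_iff.2 ⟨(hF.coherent α β h).subset ?_, Set.finite_empty.subset ?_⟩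
    · rintro x ⟨hx, hx'⟩
      exact ⟨hx.2, fun h => hx' ⟨hx.2, hx, h.symm⟩⟩
    · rintro x ⟨hx, hx'⟩
      exact hx' hx.2.1
  · obtain ⟨δ, hδ⟩ := hF.invariant A
    refine ⟨δ, fun α hα => ⟨hF.almostEq_image hα (hδ α hα), ?_⟩⟩
    rw [Set.sdiff_eq]
    refine hF.almostEq_image hα ((hδ α hα).subset ?_)
    rintro x ⟨hx, hx'⟩
    exact ⟨hx, fun h => hx' (not_congr h)⟩

/-! ### The induced automorphism and its nontriviality -/

theorem exists_mk_preimage_eq (hF : IsGuidedSequence F) (A : Set ℕ) :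
    ∃ δ, ∀ α, δ ≤ α → PModFin.mk (F α ⁻¹' A) = PModFin.mk (F δ ⁻¹' A) := by
  obtain ⟨δ, hδ⟩ := hF.invariant A
  refine ⟨δ, fun α hα => PModFin.mk_eq_mk.2 ?_⟩
  have hfin := (hδ α hα).union (hF.coherent δ α hα)
  have key : ∀ x, ¬ (F α x ∈ A ↔ F δ x ∈ A) →
      x ∈ {x | F δ x = x ∧ ¬ (x ∈ A ↔ F α x ∈ A)} ∪ {x | F δ x ≠ x ∧ F α x ≠ F δ x} := by
    intro x hx
    by_cases h : F δ x = x
    · rw [h] at hx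
      exact Or.inl ⟨h, fun h' => hx h'.symm⟩
    · exact Or.inr ⟨h, fun h' => hx (by rw [h'])⟩
  constructor
  · exact hfin.subset fun x hx => key x fun h => hx.2 (h.1 hx.1)
  · exact hfin.subset fun x hx => key x fun h => hx.2 (h.2 hx.1)

/-- Below the support of `F α` the limit is already reached at `α`. -/
theorem mk_preimage_eq_of_subset (hF : IsGuidedSequence F) {α β : W} (hαβ : α ≤ β) {S : Set ℕ}
    (hS : ∀ x ∈ S, F α x ≠ x) : PModFin.mk (F β ⁻¹' S) = PModFin.mk (F α ⁻¹' S) := by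
  refine PModFin.mk_eq_mk.2 ⟨((hF.coherent α β hαβ).image (F β)).subset ?_,
    ((hF.coherent α β hαβ).image (F α)).subset ?_⟩
  · rintro x ⟨hx, hx'⟩
    refine ⟨F β x, ⟨hS _ hx, fun h => hx' ?_⟩, hF.involutive β x⟩
    rw [hF.involutive β x] at h
    change F α x ∈ S
    rw [h, hF.involutive α]
    exact hx
  · rintro x ⟨hx, hx'⟩
    refine ⟨F α x, ⟨hS _ hx, fun h => hx' ?_⟩, hF.involutive α x⟩
    rw [hF.involutive α x] at h
    change F β x ∈ S
    rw [← h, hF.involutive β]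
    exact hx

theorem finite_preimage_sdiff (hF : IsGuidedSequence F) (α : W) {A B : Set ℕ}
    (h : (A \ B).Finite) : (F α ⁻¹' A \ F α ⁻¹' B).Finite :=
  (Set.Finite.preimage (hF.involutive α).injective.injOn h).subset fun _ hx => hx

theorem mk_preimage_congr (hF : IsGuidedSequence F) (α : W) {A B : Set ℕ}
    (h : PModFin.mk A = PModFin.mk B) : PModFin.mk (F α ⁻¹' A) = PModFin.mk (F α ⁻¹' B) := by
  rw [PModFin.mk_eq_mk] at h ⊢
  exact ⟨hF.finite_preimage_sdiff α h.1, hF.finite_preimage_sdiff α h.2⟩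

theorem exists_orderIso (hF : IsGuidedSequence F) : ∃ φ : PModFin ≃o PModFin,
    ∀ A : Set ℕ, ∃ δ, ∀ α, δ ≤ α → φ (PModFin.mk A) = PModFin.mk (F α ⁻¹' A) := by
  choose δ hδ using hF.exists_mk_preimage_eq
  let φ : PModFin → PModFin := fun a => PModFin.mk (F (δ a.out) ⁻¹' a.out)
  have hφ : ∀ A : Set ℕ, ∃ δ, ∀ α, δ ≤ α → φ (PModFin.mk A) = PModFin.mk (F α ⁻¹' A) :=
    fun A => ⟨δ (PModFin.mk A).out, fun α hα =>
      (hδ _ α hα).symm.trans (hF.mk_preimage_congr α (Quotient.out_eq (PModFin.mk A)))⟩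
  -- At an index late enough for both applications, `φ ∘ φ` is computed by one involution applied
  -- twice.
  have hinv : ∀ a, φ (φ a) = a := by
    rintro ⟨A⟩
    change φ (φ (PModFin.mk A)) = PModFin.mk A
    obtain ⟨δ₁, h₁⟩ := hφ A
    obtain ⟨δ₂, h₂⟩ := hφ (F δ₁ ⁻¹' A)
    rw [h₁ δ₁ le_rfl, h₂ _ (le_max_right δ₁ δ₂), hF.mk_preimage_congr (max δ₁ δ₂)
      ((h₁ δ₁ le_rfl).symm.trans (h₁ _ (le_max_left δ₁ δ₂))), ← Set.preimage_comp,
      (hF.involutive _).comp_self, Set.preimage_id]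
  have hmono : ∀ a b, a ≤ b → φ a ≤ φ b := by
    rintro ⟨A⟩ ⟨B⟩ h
    change φ (PModFin.mk A) ≤ φ (PModFin.mk B)
    obtain ⟨δ₁, h₁⟩ := hφ A
    obtain ⟨δ₂, h₂⟩ := hφ B
    rw [h₁ _ (le_max_left δ₁ δ₂), h₂ _ (le_max_right δ₁ δ₂)]
    exact hF.finite_preimage_sdiff _ h
  refine ⟨⟨⟨φ, φ, hinv, hinv⟩, fun {a b} => ⟨fun h => ?_, hmono a b⟩⟩, hφ⟩
  have := hmono _ _ h
  simpa [hinv] using this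

/-- Otherwise some infinite `A` inside the support of `F α` has disjoint images under `e` and `F α`,
yet both images represent `φ (mk A)`. -/
theorem finite_moved_ne (hF : IsGuidedSequence F) {φ : PModFin ≃o PModFin}
    (hφ : ∀ A : Set ℕ, ∃ δ, ∀ α, δ ≤ α → φ (PModFin.mk A) = PModFin.mk (F α ⁻¹' A))
    {X : Set ℕ} {e : ℕ → ℕ} (hX : Xᶜ.Finite) (he : X.InjOn e)
    (heφ : ∀ A : Set ℕ, φ (PModFin.mk A) = PModFin.mk (e '' (A ∩ X))) (α : W) :
    {x | F α x ≠ x ∧ ¬ (x ∈ X ∧ e x = F α x)}.Finite := by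
  by_contra hinf
  have hE : ({x | F α x ≠ x ∧ ¬ (x ∈ X ∧ e x = F α x)} \ Xᶜ).Infinite :=
    Set.Infinite.sdiff hinf hX
  obtain ⟨A, hAE, hA, hsep⟩ := exists_infinite_separated hE
    (he.mono fun x hx => not_not.1 hx.2) (hF.involutive α).injective.injOn
    fun x hx h => hx.1.2 ⟨not_not.1 hx.2, h⟩
  obtain ⟨δ, hδ⟩ := hφ A
  have h := hδ _ (le_max_left δ α)
  rw [hF.mk_preimage_eq_of_subset (le_max_right δ α) fun x hx => (hAE hx).1.1, heφ,
    PModFin.mk_eq_mk] at h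
  refine (hA.image ((hF.involutive α).injective.injOn)) (h.2.subset ?_)
  rintro _ ⟨y, hy, rfl⟩
  refine ⟨?_, ?_⟩
  · change F α (F α y) ∈ A
    rwa [hF.involutive α y]
  · rintro ⟨x, hx, hxy⟩
    exact hsep x hx.1 y hy hxy

theorem exists_not_isTrivialAut [Nonempty W] [NoMaxOrder W] (hF : IsGuidedSequence F) :
    ∃ φ : PModFin ≃o PModFin, ¬ IsTrivialAut φ := by
  obtain ⟨φ, hφ⟩ := hF.exists_orderIso
  refine ⟨φ, ?_⟩
  rintro ⟨X, Y, e, hX, -, he, heφ⟩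
  have hfin := hF.finite_moved_ne hφ hX he.injOn heφ
  -- One point from each 2-cycle of `e`. Depending on `e` alone, this set is fixed before `δ` and
  -- `α` are chosen.
  let A : Set ℕ := {x | x ∈ X ∧ x < e x ∧ e (e x) = x}
  obtain ⟨δ, hδ⟩ := hF.invariant A
  obtain ⟨α, hα⟩ := exists_gt δ
  -- Each newly moved `x` is an invariance failure for `A`, or `e` differs from `F α` at `x` or at
  -- `F α x`: finitely many points in all.
  refine hF.increasing δ α hα (((hδ α hα.le).union ((hfin α).union
    ((hfin α).image (F α)))).subset ?_)
  rintro x ⟨hδx, hαx⟩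
  by_cases h₁ : x ∈ X ∧ e x = F α x
  · by_cases h₂ : F α x ∈ X ∧ e (F α x) = F α (F α x)
    · left
      refine ⟨hδx, ?_⟩
      rw [hF.involutive α x] at h₂
      rcases lt_or_gt_of_ne hαx with h | h
      · have hmem : F α x ∈ A := ⟨h₂.1, by rwa [h₂.2], by rw [h₂.2, h₁.2]⟩
        exact fun h' => absurd (h'.2 hmem).2.1 (by rw [h₁.2]; exact h.not_gt)
      · have hmem : x ∈ A := ⟨h₁.1, by rwa [h₁.2], by rw [h₁.2, h₂.2]⟩
        exact fun h' => absurd (h'.1 hmem).2.1 (by rw [h₂.2]; exact h.not_gt)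
    · refine Or.inr (Or.inr ⟨F α x, ⟨?_, h₂⟩, hF.involutive α x⟩)
      rw [hF.involutive α x]
      exact Ne.symm hαx
  · exact Or.inr (Or.inl ⟨hαx, h₁⟩)

end IsGuidedSequence

/-! ### The construction -/

/-- The block containing `x`; block `n` lies below `2 ^ 2 ^ (n + 1)`. -/
def block (x : ℕ) : ℕ := Nat.log 2 (Nat.log 2 x)

theorem lt_of_block (x : ℕ) : x < 2 ^ 2 ^ (block x + 1) :=
  (Nat.lt_pow_succ_log_self (by norm_num) x).trans_le
    (Nat.pow_le_pow_right (by norm_num) (Nat.lt_pow_succ_log_self (by norm_num) (Nat.log 2 x)))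

/-- The points of the `n`-th block. -/
def blockSet (n : ℕ) : Finset ℕ := (Finset.range (2 ^ 2 ^ (n + 1))).filter fun x => block x = n

theorem mem_blockSet {n x : ℕ} : x ∈ blockSet n ↔ block x = n := by
  rw [blockSet, Finset.mem_filter, Finset.mem_range, and_iff_right_iff_imp]
  rintro rfl
  exact lt_of_block x

/-- Block `n` contains the interval from `m = 2 ^ 2 ^ n` to `m ^ 2`, and `m ^ 2 - m ≥ m`. -/
theorem le_card_blockSet (n : ℕ) : 2 ^ 2 ^ n ≤ (blockSet n).card := by
  have hsub : Finset.Ico (2 ^ 2 ^ n) (2 ^ 2 ^ (n + 1)) ⊆ blockSet n := by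
    intro x hx
    rw [Finset.mem_Ico] at hx
    have hx₀ : x ≠ 0 := (lt_of_lt_of_le (by positivity) hx.1).ne'
    rw [mem_blockSet, block]
    have h₁ : 2 ^ n ≤ Nat.log 2 x := Nat.le_log_of_pow_le (by norm_num) hx.1
    have h₂ : Nat.log 2 x < 2 ^ (n + 1) := Nat.log_lt_of_lt_pow hx₀ hx.2
    exact Nat.log_eq_of_pow_le_of_lt_pow h₁ h₂
  refine le_trans ?_ (Finset.card_le_card hsub)
  rw [Nat.card_Ico, pow_succ, pow_mul]
  have h : 2 ≤ 2 ^ 2 ^ n := Nat.le_self_pow (by positivity) 2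
  rw [sq]
  exact Nat.le_sub_of_add_le (by nlinarith)

theorem eventually_lt_card_blockSet (k : ℕ) :
    ∀ᶠ n in Filter.atTop, n + 2 ^ (k * (n + 1)) < (blockSet n).card := by
  have hlin : ∀ n ≥ 2 * (k + 4), (k + 1) * (n + 1) + 1 ≤ 2 ^ n := by
    intro n hn
    induction n, hn using Nat.le_induction with
    | base =>
      have h : k + 4 < 2 ^ (k + 4) := Nat.lt_two_pow_self
      have h' : 2 * (k + 2) ≤ 2 ^ (k + 4) := by
        have : k + 2 < 2 ^ (k + 2) := Nat.lt_two_pow_self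
        have h'' : 2 ^ (k + 4) = 4 * 2 ^ (k + 2) := by ring
        omega
      rw [two_mul, pow_add]
      nlinarith
    | succ n _ ih =>
      rw [pow_succ]
      nlinarith
  filter_upwards [Filter.eventually_ge_atTop (2 * (k + 4))] with n hn
  refine lt_of_lt_of_le ?_ (le_card_blockSet n)
  refine lt_of_lt_of_le ?_ (Nat.pow_le_pow_right (by norm_num) (hlin n hn))
  have h₁ : n < 2 ^ n := Nat.lt_two_pow_self
  have h₂ : 2 ^ n ≤ 2 ^ ((k + 1) * (n + 1)) := Nat.pow_le_pow_right (by norm_num) (by nlinarith)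
  have h₃ : 2 ^ (k * (n + 1)) ≤ 2 ^ ((k + 1) * (n + 1)) :=
    Nat.pow_le_pow_right (by norm_num) (by nlinarith)
  rw [pow_succ]
  omega

theorem finite_of_eventually_blockSet {p : ℕ → Prop}
    (h : ∀ᶠ n in Filter.atTop, ∀ x ∈ blockSet n, ¬ p x) : {x | p x}.Finite := by
  obtain ⟨N, hN⟩ := Filter.eventually_atTop.1 h
  refine ((Finset.range N).biUnion blockSet).finite_toSet.subset fun x hx => ?_
  refine Finset.mem_coe.2 (Finset.mem_biUnion.2 ⟨block x, Finset.mem_range.2 ?_, mem_blockSet.2 rfl⟩)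
  by_contra hlt
  exact hN _ (not_lt.1 hlt) x (mem_blockSet.2 rfl) hx

theorem infinite_of_eventually_blockSet {p : ℕ → Prop}
    (h : ∀ᶠ n in Filter.atTop, ∃ x ∈ blockSet n, p x) : {x | p x}.Infinite := by
  intro hfin
  have hblock := (hfin.image block).eventually_cofinite_notMem
  rw [Nat.cofinite_eq_atTop] at hblock
  obtain ⟨n, ⟨x, hx, hpx⟩, hn⟩ := (h.and hblock).exists
  exact hn ⟨x, hpx, mem_blockSet.1 hx⟩

theorem exists_isGuidedSequence {W : Type*} [LinearOrder W] [WellFoundedLT W]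
    (hW : ∀ α : W, (Set.Iio α).Countable) {C : W → ℕ → Finset (Finset ℕ)}
    (hC : ∀ α n, (C α n).card ≤ n + 1)
    (hguess : ∀ A : Set ℕ, ∃ α, ∀ n, truncation A n ∈ C α n) :
    ∃ F : W → ℕ → ℕ, IsGuidedSequence F := by
  classical
  obtain ⟨f, hf, hff⟩ := exists_coherent_involutions eventually_lt_card_blockSet hC hW
  have hinv : ∀ α x, block (f α (block x) x) = block x ∧
      f α (block x) (f α (block x) x) = x := fun α x => by
    have := (hf α).1 (block x) x (mem_blockSet.2 rfl)
    rwa [mem_blockSet] at this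
  -- The truncation at `n` reaches past block `n`, so it decides membership in `A` there.
  have hmem : ∀ (A : Set ℕ) (x : ℕ), x ∈ truncation A (block x) ↔ x ∈ A := fun A x => by
    simp [truncation, lt_of_block]
  refine ⟨fun α x => f α (block x) x, fun α x => ?_, fun α β h => ?_, fun α β h => ?_,
    fun A => ?_⟩
  · simp only [(hinv α x).1, (hinv α x).2]
  · rcases h.eq_or_lt with rfl | h
    · simp
    · refine finite_of_eventually_blockSet ((hff β α h).1.mono fun n hn x hx hp => ?_)
      obtain rfl := mem_blockSet.1 hx
      exact hp.2 (hn x hx hp.1)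
  · refine infinite_of_eventually_blockSet ((hff β α h).2.1.mono fun n => ?_)
    rintro ⟨x, hx, hp⟩
    obtain rfl := mem_blockSet.1 hx
    exact ⟨x, hx, hp⟩
  · obtain ⟨δ, hδ⟩ := hguess A
    refine ⟨δ, fun α h => ?_⟩
    rcases h.eq_or_lt with rfl | h
    · refine Set.finite_empty.subset fun x hx => hx.2 ?_
      rw [show f δ (block x) x = x from hx.1]
    · refine finite_of_eventually_blockSet (((hff α δ h).2.2 δ le_rfl).mono fun n hn x hx hp => ?_)
      obtain rfl := mem_blockSet.1 hx
      have := hn x hx hp.1 _ (hδ _)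
      have himage := hmem A (f α (block x) x)
      rw [(hinv α x).1] at himage
      rw [hmem, himage] at this
      exact hp.2 this

theorem countable_Iio_omegaOne (α : OmegaOne.{u}) : (Set.Iio α).Countable := by
  have h : (Set.Iio α.1).Countable := by
    rw [← Cardinal.le_aleph0_iff_set_countable, Cardinal.mk_Iio_ordinal, Cardinal.lift_le_aleph0,
      ← Order.lt_succ_iff, Cardinal.succ_aleph0]
    exact Cardinal.lt_omega_iff_card_lt.1 α.2
  exact (h.preimage Subtype.val_injective).mono fun β hβ => hβ

theorem mainTheorem2 (V : Set ZFSet.{u}) (hV : IsInnerModel V)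
    (hω₁ : IsOmegaOneIn V (ω_ 1 : Ordinal.{u}).toZFSet)
    (hLP : DaggerLP V ∨ DiamondMinusLP V ∨ DiamondLP V) :
    (∃ (D : OmegaOne.{u} → Set ℕ) (f : OmegaOne.{u} → ℕ → ℕ), IsBowtieOfInvolutions D f) ∧
      ∃ F : PModFin ≃o PModFin, ¬ IsTrivialAut F := by
  have hdagger : DaggerLP V := by
    rcases hLP with h | h | h
    · exact h
    · exact h.daggerLP
    · exact h.daggerLP
  obtain ⟨C, hC, hguess⟩ := hdagger.exists_guessing hV
  obtain ⟨F, hF⟩ := exists_isGuidedSequence countable_Iio_omegaOne hC hguess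
  have : Nonempty OmegaOne.{u} := ⟨natOmegaOne 0⟩
  have : NoMaxOrder OmegaOne.{u} := ⟨fun α =>
    ⟨⟨Order.succ α.1, (Cardinal.isSuccLimit_omega 1).succ_lt α.2⟩, Order.lt_succ α.1⟩⟩
  exact ⟨⟨_, F, hF.isBowtieOfInvolutions⟩, hF.exists_not_isTrivialAut⟩
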